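/- Let $(\Omega,\mathcal F,(\mathcal F_t)_{t\ge 0},\mathbf P)$ be a filtered probability space carrying a space-time white noise $W$ on $[0,\infty)\times\mathbf R$ relative to $(\mathcal F_t)$: the Wiener integrals $W(\varphi)=\int\varphi(s,y)\,W(dy\,ds)$, $\varphi\in L^2([0,\infty)\times\mathbf R)$, form a centered Gaussian family with $\mathbf E[W(\varphi)W(\psi)]=\langle\varphi,\psi\rangle_{L^2}$; $W(\varphi)$ is $\mathcal F_t$-measurable if $\varphi$ vanishes a.e. after time $t$; and the $W(\varphi)$ with $\varphi$ vanishing a.e. up to time $t$ are jointly independent of $\mathcal F_t$. Let $\sigma>0$, let $u_0:\mathbf R\to[0,\infty)$ be continuous, and let $b:\mathbf R\to[0,\infty)$ be locally Lipschitz and nondecreasing on $(0,\infty)$. Consider the equation $$\partial_t u(t,x)=\Delta u(t,x)+b(u(t,x))+\sigma\dot W(t,x),\qquad x\in\mathbf R,\ t>0,\qquad u(0,x)=u_0(x).$$ A local (mild, random field) solution up to a stopping time $\tau$ with values in $[0,\infty]$ is a jointly measurable process $u=\{u(t,x)\}_{t\ge 0,\,x\in\mathbf R}$ with real values, adapted to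 $(\mathcal F_t)$, such that for every $t>0$ and $x\in\mathbf R$, almost surely on $\{t<\tau\}$, the two Lebesgue integrals below converge absolutely and $$u(t,x)=\int_{\mathbf R}G(t,x,y)u_0(y)\,dy+\int_0^t\!\int_{\mathbf R}G(t-s,x,y)\,b(u(s,y))\,dy\,ds+\sigma\int_0^t\!\int_{\mathbf R}G(t-s,x,y)\,W(dy\,ds),$$ where $G(t,x,y)=(4\pi t)^{-1/2}e^{-(x-y)^2/(4t)}$. It is a global solution on the event $\{\tau=\infty\}$. If $b$ satisfies the Osgood condition, that is, $\int_a^\infty\frac{ds}{b(s)}<\infty$ for some $a>0$ (with $1/0=\infty$), then almost surely there is no global solution: every local solution $(u,\tau)$ satisfies $\tau<\infty$ almost surely. In particular (taking $\tau\equiv\infty$), no global solution exists. In particular, there is no Fujita exponent: for every $\eta>0$, every continuous $u_0\ge 0$, and every locally Lipschitz $b:\mathbf R\to[0,\infty)$ with $b(r)=r^{1+\eta}$ for all $r\ge 0$, almost surely there is no global solution, in the same sense. -/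

import Mathlib

open MeasureTheory ProbabilityTheory Set
open scoped NNReal ENNReal

noncomputable section

namespace StochasticHeat

/-- The heat kernel of the Laplacian on the real line,
`G(t, x, y) = (4 π t)^(-1/2) exp (-(x - y)² / (4 t))` for `t > 0`. -/
def heatKernel (t x y : ℝ) : ℝ :=
  (√(4 * Real.pi * t))⁻¹ * Real.exp (-(x - y) ^ 2 / (4 * t))

/-- Lebesgue measure on `[0, ∞) × ℝ` (first coordinate: time). -/
def spaceTime : Measure (ℝ × ℝ) :=
  ((volume : Measure ℝ).restrict (Ici 0)).prod volume

/-- The integrand `(s, y) ↦ 1_{0 < s < t} G(t - s, x, y)` of the stochastic convolution. -/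
def convKernel (t x : ℝ) : ℝ × ℝ → ℝ :=
  (Ioo 0 t ×ˢ univ).indicator fun p => heatKernel (t - p.1) x p.2

lemma measurable_convKernel (t x : ℝ) : Measurable (convKernel t x) := by
  unfold convKernel heatKernel
  refine Measurable.indicator ?_ (measurableSet_Ioo.prod MeasurableSet.univ)
  fun_prop

lemma sq_heatKernel {r : ℝ} (hr : 0 < r) (x y : ℝ) :
    heatKernel r x y ^ 2 = (4 * Real.pi * r)⁻¹ * Real.exp (-(1 / (2 * r)) * (y - x) ^ 2) := by
  unfold heatKernel
  rw [mul_pow, inv_pow, Real.sq_sqrt (by positivity), ← Real.exp_nat_mul]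
  congr 2
  field_simp
  ring

/-- The heat kernel on `(0, t) × ℝ` is square integrable, so that its Wiener integral makes
sense. -/
lemma memLp_convKernel (t x : ℝ) : MemLp (convKernel t x) 2 spaceTime := by
  have hm := measurable_convKernel t x
  rw [memLp_two_iff_integrable_sq hm.aestronglyMeasurable]
  unfold spaceTime
  have key : ∀ s ∈ Ioo 0 t, ∀ y, convKernel t x (s, y) ^ 2
      = (4 * Real.pi * (t - s))⁻¹ * Real.exp (-(1 / (2 * (t - s))) * (y - x) ^ 2) := by
    intro s hs y
    rw [← sq_heatKernel (sub_pos.2 hs.2)]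
    simp [convKernel, hs.1, hs.2]
  have key0 : ∀ s ∉ Ioo 0 t, ∀ y, convKernel t x (s, y) ^ 2 = 0 := by
    intro s hs y
    have : (s, y) ∉ Ioo 0 t ×ˢ (univ : Set ℝ) := fun h => hs h.1
    simp [convKernel, indicator_of_notMem this]
  rw [integrable_prod_iff (hm.pow_const 2).aestronglyMeasurable]
  constructor
  · refine Filter.Eventually.of_forall fun s => ?_
    by_cases hs : s ∈ Ioo 0 t
    · simp_rw [key s hs]
      have h : 0 < 1 / (2 * (t - s)) := by
        have := sub_pos.2 hs.2
        positivity
      exact ((integrable_exp_neg_mul_sq h).comp_sub_right x).const_mul _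
    · simp_rw [key0 s hs]
      exact integrable_zero _ _ _
  · have hint : (fun s => ∫ y, ‖convKernel t x (s, y) ^ 2‖)
        = (Ioo 0 t).indicator fun s =>
          (√(2 * Real.pi) / (4 * Real.pi)) * (t - s) ^ (-(1 / 2) : ℝ) := by
      funext s
      by_cases hs : s ∈ Ioo 0 t
      · have hr := sub_pos.2 hs.2
        simp_rw [Real.norm_of_nonneg (sq_nonneg _), key s hs]
        rw [integral_const_mul,
          integral_sub_right_eq_self (fun y => Real.exp (-(1 / (2 * (t - s))) * y ^ 2)) x,
          integral_gaussian, indicator_of_mem hs, Real.rpow_neg hr.le, ← Real.sqrt_eq_rpow,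
          show Real.pi / (1 / (2 * (t - s))) = (2 * Real.pi) * (t - s) by field_simp,
          Real.sqrt_mul (by positivity)]
        have h2 : √(t - s) * √(t - s) = t - s := Real.mul_self_sqrt hr.le
        have h3 : 0 < √(t - s) := Real.sqrt_pos.2 hr
        rw [show (4 * Real.pi * (t - s)) = 4 * Real.pi * (√(t - s) * √(t - s)) by rw [h2]]
        field_simp
      · simp_rw [key0 s hs]
        simp [indicator_of_notMem hs]
    rw [hint]
    refine Integrable.mono_measure ?_ Measure.restrict_le_self
    rw [integrable_indicator_iff measurableSet_Ioo]
    refine Integrable.const_mul ?_ _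
    rcases le_or_gt t 0 with ht | ht
    · simp [Ioo_eq_empty_of_le ht]
    · have h := (intervalIntegral.intervalIntegrable_rpow' (a := 0) (b := t)
        (r := (-(1 / 2) : ℝ)) (by norm_num)).comp_sub_left t
      rw [sub_zero, sub_self] at h
      exact ((intervalIntegrable_iff_integrableOn_Ioo_of_le ht.le).1 h.symm)

variable {Ω : Type*} {mΩ : MeasurableSpace Ω}

/-- Space-time white noise on `[0, ∞) × ℝ`, given by its Wiener integrals
`W φ = ∫ φ(s, y) W(dy ds)` for `φ ∈ L²([0, ∞) × ℝ)`: a centered Gaussian family with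
`E[W φ W ψ] = ⟨φ, ψ⟩`, which is moreover a white noise relative to the filtration `ℱ`:
the noise before time `t` is `ℱ t`-measurable and the noise after time `t` is
independent of `ℱ t`. -/
structure IsWhiteNoise (W : Lp ℝ 2 spaceTime → Ω → ℝ) (ℱ : Filtration ℝ≥0 mΩ)
    (P : Measure Ω) : Prop where
  measurable : ∀ φ, Measurable (W φ)
  gaussian : IsGaussianProcess W P
  centered : ∀ φ, ∫ ω, W φ ω ∂P = 0
  covariance : ∀ φ ψ, ∫ ω, W φ ω * W ψ ω ∂P = inner ℝ φ ψ
  adapted : ∀ (t : ℝ≥0) (φ : Lp ℝ 2 spaceTime),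
    (∀ᵐ p ∂spaceTime, (t : ℝ) < p.1 → φ p = 0) → Measurable[ℱ t] (W φ)
  indep : ∀ t : ℝ≥0,
    Indep (⨆ φ ∈ {φ : Lp ℝ 2 spaceTime | ∀ᵐ p ∂spaceTime, p.1 ≤ (t : ℝ) → φ p = 0},
      (borel ℝ).comap (W φ)) (ℱ t) P

/-- The stochastic convolution `∫₀ᵗ ∫_ℝ G(t - s, x, y) W(dy ds)`. -/
def stochConv (W : Lp ℝ 2 spaceTime → Ω → ℝ) (t x : ℝ) : Ω → ℝ :=
  W ((memLp_convKernel t x).toLp (convKernel t x))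

/-- The mild equation at the point `(t, x)`, along a given `ω`:
`u(t,x) = ∫ G(t,x,y) u₀(y) dy + ∫₀ᵗ ∫ G(t-s,x,y) b(u(s,y)) dy ds + σ z`,
where `v` is the path of `u` and `z` the value of the stochastic convolution.
The two Lebesgue integrals are required to converge absolutely. -/
def MildEquationAt (σ : ℝ) (b u₀ : ℝ → ℝ) (v : ℝ≥0 → ℝ → ℝ) (z : ℝ) (t : ℝ≥0) (x : ℝ) : Prop :=
  Integrable (fun y => heatKernel t x y * u₀ y) ∧
  IntegrableOn (fun p : ℝ × ℝ => heatKernel (t - p.1) x p.2 * b (v p.1.toNNReal p.2))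
    (Ioo 0 (t : ℝ) ×ˢ univ) ∧
  v t x = (∫ y, heatKernel t x y * u₀ y)
    + (∫ s in (0 : ℝ)..t, ∫ y, heatKernel (t - s) x y * b (v s.toNNReal y))
    + σ * z

/-- `u` is a local random field solution up to the stopping time `τ` of
`∂ₜ u = Δ u + b(u) + σ Ẇ` on `ℝ` with `u(0, ·) = u₀`. The value `τ = ⊤` is allowed. -/
structure IsLocalSolution (W : Lp ℝ 2 spaceTime → Ω → ℝ) (ℱ : Filtration ℝ≥0 mΩ)
    (P : Measure Ω) (σ : ℝ) (b u₀ : ℝ → ℝ) (u : ℝ≥0 → ℝ → Ω → ℝ) (τ : Ω → WithTop ℝ≥0) :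
    Prop where
  stopping : IsStoppingTime ℱ τ
  measurable : Measurable fun p : ℝ≥0 × ℝ × Ω => u p.1 p.2.1 p.2.2
  adapted : ∀ x, Adapted ℱ fun t => u t x
  mild : ∀ (t : ℝ≥0), 0 < t → ∀ x : ℝ, ∀ᵐ ω ∂P, (t : WithTop ℝ≥0) < τ ω →
    MildEquationAt σ b u₀ (fun s y => u s y ω) (stochConv W t x ω) t x

/-- Almost surely, there is no global solution: a local solution, up to whatever stopping time
`τ`, has `τ < ∞` almost surely. -/
def AlmostSurelyNoGlobalSolution (W : Lp ℝ 2 spaceTime → Ω → ℝ) (ℱ : Filtration ℝ≥0 mΩ)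
    (P : Measure Ω) (σ : ℝ) (b u₀ : ℝ → ℝ) : Prop :=
  ∀ (u : ℝ≥0 → ℝ → Ω → ℝ) (τ : Ω → WithTop ℝ≥0),
    IsLocalSolution W ℱ P σ b u₀ u τ → ∀ᵐ ω ∂P, τ ω < ⊤

/-- The Osgood condition `∫_a^∞ ds / b(s) < ∞` for some `a > 0`, with `1 / 0 = ∞`. -/
def Osgood (b : ℝ → ℝ) : Prop :=
  ∃ a : ℝ, 0 < a ∧ ∫⁻ s in Ioi a, (ENNReal.ofReal (b s))⁻¹ < ∞

end StochasticHeat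

end

/-! On an unbounded line the noise gets unboundedly many nearly independent attempts, and one of
them is so favourable that the reaction term must explode. Every local solution is in fact shown to
stop by time 3.

Since `u₀` and `b` are nonnegative, the solution dominates `σ` times the stochastic convolution.
Suppose that the convolution is at least `M 0 / σ` throughout a window `[2, 3) × [a, a + 1)`. The
solution is then at least `M 0` there. Whenever it is at least `M k` after time `T k`, the reaction
over `(T k, T (k + 1))` alone lifts it to `M (k + 1) = 2 * M k`, because the heat kernel keeps a
fixed fraction of mass in the interval (`massBound_le`, `le_integral_reaction`). The doubling times
are comparable to `M k / b (M k)`, hence summable by the Osgood condition (`Osgood.exists_levels`).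
All levels are reached by time 5/2, which a real value cannot survive (`IsLocalSolution.ae_notMem`).

It remains to find such a window with probability near 1 (`IsIsonormal.exists_window`,
`exists_gridEvent`). Take `N` distant windows and the normalized indicators `e n` of boxes below
them. The convolution on window `n` splits into a multiple, bounded below, of the standard Gaussian
`W (e n)`, negligible multiples of the other `W (e l)`, and a residual independent of all of them.
Chaining bounds the residual below by a constant `-K` that does not depend on `N`. For `N` large
some `W (e n)` is huge. The first such `n` is chosen independently of the residuals, so only one
residual, not all `N`, has to be good.

No continuous version of the field is used: bounds on a countable grid pass to each fixed point
almost surely, and Fubini makes them usable under the integrals. -/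

namespace StochasticHeat

/-! ### Isonormal processes: linearity, tails, independence -/

/-- An isonormal Gaussian process over an inner product space. -/
structure IsIsonormal {H Ω : Type*} [NormedAddCommGroup H] [InnerProductSpace ℝ H]
    {mΩ : MeasurableSpace Ω} (W : H → Ω → ℝ) (P : Measure Ω) : Prop where
  measurable : ∀ φ, Measurable (W φ)
  gaussian : IsGaussianProcess W P
  centered : ∀ φ, ∫ ω, W φ ω ∂P = 0
  covariance : ∀ φ ψ, ∫ ω, W φ ω * W ψ ω ∂P = inner ℝ φ ψ

namespace IsIsonormal

variable {H Ω : Type*} [NormedAddCommGroup H] [InnerProductSpace ℝ H] {mΩ : MeasurableSpace Ω}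
  {P : Measure Ω} {W : H → Ω → ℝ}

lemma memLp (hW : IsIsonormal W P) (φ : H) : MemLp (W φ) 2 P :=
  (hW.gaussian.hasGaussianLaw_eval φ).memLp_two

lemma inner_toLp (hW : IsIsonormal W P) (φ ψ : H) :
    inner ℝ ((hW.memLp φ).toLp (W φ)) ((hW.memLp ψ).toLp (W ψ)) = inner ℝ φ ψ := by
  rw [L2.inner_def, ← hW.covariance]
  refine integral_congr_ae ?_
  filter_upwards [(hW.memLp φ).coeFn_toLp, (hW.memLp ψ).coeFn_toLp] with ω h1 h2
  rw [h1, h2]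
  simp [mul_comm]

/-- Linearity is not an axiom; the covariance forces it. The map from `H` to `L²` preserves inner
products, so the difference of the two sides has norm zero. -/
lemma add_smul_ae (hW : IsIsonormal W P) (φ ψ : H) (c : ℝ) :
    W (φ + c • ψ) =ᵐ[P] fun ω => W φ ω + c * W ψ ω := by
  have h : (hW.memLp (φ + c • ψ)).toLp (W (φ + c • ψ))
      = (hW.memLp φ).toLp (W φ) + c • (hW.memLp ψ).toLp (W ψ) := by
    rw [← sub_eq_zero, ← inner_self_eq_zero (𝕜 := ℝ)]
    simp only [inner_sub_left, inner_sub_right, inner_add_left, inner_add_right,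
      inner_smul_left, inner_smul_right, hW.inner_toLp]
    ring
  filter_upwards [(hW.memLp (φ + c • ψ)).coeFn_toLp, (hW.memLp φ).coeFn_toLp,
    (hW.memLp ψ).coeFn_toLp, Lp.coeFn_add ((hW.memLp φ).toLp (W φ)) (c • (hW.memLp ψ).toLp (W ψ)),
    Lp.coeFn_smul c ((hW.memLp ψ).toLp (W ψ))] with ω h1 h2 h3 h4 h5
  rw [← h1, h, h4, Pi.add_apply, h5, Pi.smul_apply, h2, h3, smul_eq_mul]

lemma sub_ae (hW : IsIsonormal W P) (φ ψ : H) :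
    W (φ - ψ) =ᵐ[P] fun ω => W φ ω - W ψ ω := by
  have h := hW.add_smul_ae φ ψ (-1)
  rw [neg_one_smul, ← sub_eq_add_neg] at h
  filter_upwards [h] with ω hω
  rw [hω]
  ring

lemma add_sum_ae (hW : IsIsonormal W P) {ι : Type*} (s : Finset ι) (φ : H) (c : ι → ℝ)
    (ψ : ι → H) :
    W (φ + ∑ i ∈ s, c i • ψ i) =ᵐ[P] fun ω => W φ ω + ∑ i ∈ s, c i * W (ψ i) ω := by
  classical
  induction s using Finset.induction_on with
  | empty => simp
  | insert a s ha ih =>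
    rw [Finset.sum_insert ha, add_comm (c a • ψ a), ← add_assoc]
    filter_upwards [ih, hW.add_smul_ae (φ + ∑ i ∈ s, c i • ψ i) (ψ a) (c a)] with ω h1 h2
    rw [h2, h1, Finset.sum_insert ha]
    ring

variable [IsProbabilityMeasure P]

lemma cov_eq (hW : IsIsonormal W P) (φ ψ : H) : cov[W φ, W ψ; P] = inner ℝ φ ψ := by
  rw [covariance_eq_sub (hW.memLp φ) (hW.memLp ψ), hW.centered, zero_mul, sub_zero]
  exact hW.covariance φ ψ

lemma map_eq (hW : IsIsonormal W P) (φ : H) :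
    P.map (W φ) = gaussianReal 0 (‖φ‖ ^ 2).toNNReal := by
  rw [(hW.gaussian.hasGaussianLaw_eval φ).map_eq_gaussianReal, hW.centered,
    ← covariance_self (hW.measurable φ).aemeasurable, hW.cov_eq, real_inner_self_eq_norm_sq]

lemma hasSubgaussianMGF (hW : IsIsonormal W P) (φ : H) {c : ℝ≥0} (hc : ‖φ‖ ^ 2 ≤ c) :
    HasSubgaussianMGF (W φ) c P where
  integrable_exp_mul t := by
    have h := integrable_exp_mul_gaussianReal (μ := 0) (v := (‖φ‖ ^ 2).toNNReal) t
    rw [← hW.map_eq, integrable_map_measure (by fun_prop) (hW.measurable φ).aemeasurable] at h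
    exact h
  mgf_le t := by
    rw [mgf_gaussianReal (hW.map_eq φ), Real.coe_toNNReal _ (sq_nonneg _), zero_mul, zero_add]
    gcongr

lemma measure_le_abs (hW : IsIsonormal W P) (φ : H) {c a : ℝ} (hc : 0 < c) (hφ : ‖φ‖ ^ 2 ≤ c)
    (ha : 0 < a) :
    P {ω | a ≤ |W φ ω|} ≤ ENNReal.ofReal (1440 * (2 * c / a ^ 2) ^ 6) := by
  have h1 := hW.hasSubgaussianMGF φ (c := ⟨c, hc.le⟩) hφ
  have h2 := h1.neg
  have e1 := h1.measure_ge_le ha.le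
  have e2 := h2.measure_ge_le ha.le
  -- One term of the exponential series, with 6! = 720. The sixth power is enough to beat the
  -- 16-fold growth of the grid in the chaining.
  have key : Real.exp (-a ^ 2 / (2 * c)) ≤ 720 * (2 * c / a ^ 2) ^ 6 := by
    have h := Real.pow_div_factorial_le_exp (x := a ^ 2 / (2 * c)) (by positivity) 6
    rw [neg_div, Real.exp_neg, inv_le_comm₀ (Real.exp_pos _) (by positivity)]
    refine le_trans (le_of_eq ?_) h
    norm_num [Nat.factorial]
    field_simp
  have hsub : {ω | a ≤ |W φ ω|} ⊆ {ω | a ≤ W φ ω} ∪ {ω | a ≤ (-W φ) ω} := by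
    intro ω hω
    rw [mem_ofPred_eq, le_abs] at hω
    exact hω
  rw [← ofReal_measureReal]
  refine ENNReal.ofReal_le_ofReal ?_
  calc P.real {ω | a ≤ |W φ ω|} ≤ P.real ({ω | a ≤ W φ ω} ∪ {ω | a ≤ (-W φ) ω}) :=
        measureReal_mono hsub
    _ ≤ _ := measureReal_union_le _ _
    _ ≤ Real.exp (-a ^ 2 / (2 * c)) + Real.exp (-a ^ 2 / (2 * c)) := add_le_add e1 e2
    _ ≤ _ := by linarith

lemma measure_le_abs_sub (hW : IsIsonormal W P) (φ ψ : H) {c a : ℝ} (hc : 0 < c)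
    (hφ : ‖φ - ψ‖ ^ 2 ≤ c) (ha : 0 < a) :
    P {ω | a ≤ |W φ ω - W ψ ω|} ≤ ENNReal.ofReal (1440 * (2 * c / a ^ 2) ^ 6) := by
  refine le_trans (le_of_eq (measure_congr ?_)) (hW.measure_le_abs (φ - ψ) hc hφ ha)
  filter_upwards [hW.sub_ae φ ψ] with ω hω
  refine propext ?_
  change a ≤ |W φ ω - W ψ ω| ↔ a ≤ |W (φ - ψ) ω|
  rw [hω]

/-- For jointly Gaussian families, vanishing covariance is independence. -/
lemma indepFun (hW : IsIsonormal W P) {S T : Type*} (f : S → H) (g : T → H)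
    (h : ∀ s t, inner ℝ (f s) (g t) = 0) :
    IndepFun (fun ω s => W (f s) ω) (fun ω t => W (g t) ω) P := by
  refine IsGaussianProcess.indepFun_of_covariance_eq_zero (X := fun s => W (f s))
    (Y := fun t => W (g t)) ?_ (fun s => (hW.measurable _).aemeasurable)
    (fun t => (hW.measurable _).aemeasurable) fun s t => by rw [hW.cov_eq, h]
  have hXY : Sum.elim (fun s => W (f s)) (fun t => W (g t)) = W ∘ Sum.elim f g := by
    funext p
    cases p <;> rfl
  rw [hXY]
  exact hW.gaussian.comp_right _

lemma iIndepFun (hW : IsIsonormal W P) {ι : Type*} {e : ι → H} (he : Orthonormal ℝ e) :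
    ProbabilityTheory.iIndepFun (fun i => W (e i)) P := by
  have h := IsGaussianProcess.iIndepFun_of_covariance_eq_zero (P := P) (S := fun _ : ι => Unit)
    (X := fun i _ => W (e i)) (hW.gaussian.comp_right fun p : (_ : ι) × Unit => e p.1)
    (fun i _ => (hW.measurable _).aemeasurable) fun i j hij _ _ => by
      rw [hW.cov_eq, he.2 hij]
  exact h.comp (fun _ x => x ()) fun _ => measurable_pi_apply ()

/-! ### Chaining on the quaternary grid -/

/-- Chaining: a Gaussian field on the quaternary grid of the unit square whose increments between
a point and its parent have geometrically decaying variance is bounded below with high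
probability, uniformly in the field. -/
lemma exists_grid_lower_bound (hW : IsIsonormal W P) {C ε : ℝ} (hC : 0 < C) (hε : 0 < ε) :
    ∃ K : ℝ, 0 < K ∧ ∀ g : ℕ → ℕ → ℕ → H, ‖g 0 0 0‖ ^ 2 ≤ C →
      (∀ k i j, i < 4 ^ (k + 1) → j < 4 ^ (k + 1) →
        ‖g (k + 1) i j - g k (i / 4) (j / 4)‖ ^ 2 ≤ C * (1 / 2) ^ k) →
      P {ω | ∃ k i j, i < 4 ^ k ∧ j < 4 ^ k ∧ W (g k i j) ω < -K} ≤ ENNReal.ofReal ε := by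
  -- The failure probabilities will add up to (1440 + 23040 · 5/2) θ⁶, and 92160 exceeds this
  -- coefficient.
  obtain ⟨θ, hθ0, hθ1, hθε⟩ : ∃ θ : ℝ, 0 < θ ∧ θ ≤ 1 ∧ 92160 * θ ≤ ε := by
    refine ⟨min 1 (ε / 92160), by positivity, min_le_left _ _, ?_⟩
    have := min_le_right 1 (ε / 92160)
    linarith
  set κ : ℝ := √(2 * C / θ) with hκdef
  have hκ : 0 < κ := Real.sqrt_pos.2 (by positivity)
  have hκ2 : 2 * C / κ ^ 2 = θ := by
    rw [hκdef, Real.sq_sqrt (by positivity)]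
    field_simp
  refine ⟨17 * κ, by positivity, fun g h0 hstep => ?_⟩
  -- The allowed increment at level `k` is `κ * r ^ k`. The ratio must be below 1 for the increments
  -- to sum (to 16κ, plus κ for the root), yet large enough that 16 · 2⁻⁶ / r¹² < 1 for the union
  -- bound.
  set r : ℝ := 15 / 16 with hr
  let base : Set Ω := {ω | κ ≤ |W (g 0 0 0) ω|}
  let bad : ℕ → ℕ × ℕ → Set Ω := fun k p =>
    {ω | κ * r ^ k ≤ |W (g (k + 1) p.1 p.2) ω - W (g k (p.1 / 4) (p.2 / 4)) ω|}
  let idx : ℕ → Finset (ℕ × ℕ) := fun k =>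
    Finset.range (4 ^ (k + 1)) ×ˢ Finset.range (4 ^ (k + 1))
  have hsub : {ω | ∃ k i j, i < 4 ^ k ∧ j < 4 ^ k ∧ W (g k i j) ω < -(17 * κ)}
      ⊆ base ∪ ⋃ k, ⋃ p ∈ idx k, bad k p := by
    intro ω hω
    by_contra hgood
    simp only [mem_union, mem_iUnion, not_or, not_exists, base, bad, idx, Finset.mem_product,
      Finset.mem_range] at hgood
    obtain ⟨hg0, hgk⟩ := hgood
    have hg0' : |W (g 0 0 0) ω| < κ := not_le.1 hg0
    have hgk' : ∀ k i j, i < 4 ^ (k + 1) → j < 4 ^ (k + 1) →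
        |W (g (k + 1) i j) ω - W (g k (i / 4) (j / 4)) ω| < κ * r ^ k :=
      fun k i j hi hj => not_le.1 (hgk k (i, j) ⟨hi, hj⟩)
    -- Here `17 - 16 * r ^ k` is 1 plus the geometric sum of `r ^ l` over `l < k`.
    have hind : ∀ k i j, i < 4 ^ k → j < 4 ^ k → -W (g k i j) ω ≤ κ * (17 - 16 * r ^ k) := by
      intro k
      induction k with
      | zero =>
        intro i j hi hj
        obtain rfl : i = 0 := by simpa using hi
        obtain rfl : j = 0 := by simpa using hj
        have := (abs_lt.1 hg0').1
        simp only [pow_zero]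
        linarith
      | succ k ih =>
        intro i j hi hj
        have h1 := ih (i / 4) (j / 4) (by rw [pow_succ] at hi; omega)
          (by rw [pow_succ] at hj; omega)
        have h2 := (abs_lt.1 (hgk' k i j hi hj)).1
        have h3 : κ * (17 - 16 * r ^ (k + 1)) = κ * (17 - 16 * r ^ k) + κ * r ^ k := by
          rw [pow_succ, hr]
          ring
        linarith
    obtain ⟨k, i, j, hi, hj, hlt⟩ := hω
    have := hind k i j hi hj
    have : 0 < κ * r ^ k := by positivity
    nlinarith
  have hbase : P base ≤ ENNReal.ofReal (1440 * θ ^ 6) := by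
    rw [← hκ2]
    exact hW.measure_le_abs _ hC h0 hκ
  have hbad : ∀ k, P (⋃ p ∈ idx k, bad k p) ≤ ENNReal.ofReal (23040 * θ ^ 6 * (3 / 5) ^ k) := by
    intro k
    calc P (⋃ p ∈ idx k, bad k p) ≤ ∑ p ∈ idx k, P (bad k p) := measure_biUnion_finset_le _ _
      _ ≤ ∑ p ∈ idx k,
          ENNReal.ofReal (1440 * (2 * (C * (1 / 2) ^ k) / (κ * r ^ k) ^ 2) ^ 6) := by
        refine Finset.sum_le_sum fun p hp => ?_
        simp only [idx, Finset.mem_product, Finset.mem_range] at hp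
        exact hW.measure_le_abs_sub _ _ (by positivity) (hstep k p.1 p.2 hp.1 hp.2) (by positivity)
      _ = ENNReal.ofReal ((4 ^ (k + 1) * 4 ^ (k + 1)) *
          (1440 * (2 * (C * (1 / 2) ^ k) / (κ * r ^ k) ^ 2) ^ 6)) := by
        rw [Finset.sum_const, nsmul_eq_mul, ← ENNReal.ofReal_natCast,
          ← ENNReal.ofReal_mul (Nat.cast_nonneg _)]
        simp only [idx, Finset.card_product, Finset.card_range]
        push_cast
        rfl
      _ ≤ ENNReal.ofReal (23040 * θ ^ 6 * (3 / 5) ^ k) := by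
        refine ENNReal.ofReal_le_ofReal ?_
        have e1 : (4 ^ (k + 1) * 4 ^ (k + 1) : ℝ) *
            (1440 * (2 * (C * (1 / 2) ^ k) / (κ * r ^ k) ^ 2) ^ 6)
            = 23040 * θ ^ 6 * (16 * (1 / 2) ^ 6 / r ^ 12) ^ k := by
          rw [← hκ2, show (16 : ℝ) = 4 * 4 by norm_num, div_pow (4 * 4 * (1 / 2) ^ 6 : ℝ),
            mul_pow (4 * 4 : ℝ), mul_pow (4 : ℝ), ← pow_mul, ← pow_mul, mul_comm 6 k,
            mul_comm 12 k, pow_mul _ k 6, pow_mul r k 12]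
          have : r ^ k ≠ 0 := by positivity
          field_simp
          ring
        have e2 : 16 * (1 / 2) ^ 6 / r ^ 12 ≤ 3 / 5 := by
          rw [hr]
          norm_num
        rw [e1]
        exact mul_le_mul_of_nonneg_left (pow_le_pow_left₀ (by positivity) e2 k) (by positivity)
  calc P _ ≤ P (base ∪ ⋃ k, ⋃ p ∈ idx k, bad k p) := measure_mono hsub
    _ ≤ P base + ∑' k, P (⋃ p ∈ idx k, bad k p) :=
      (measure_union_le _ _).trans (add_le_add le_rfl (measure_iUnion_le _))
    _ ≤ ENNReal.ofReal (1440 * θ ^ 6) + ∑' k, ENNReal.ofReal (23040 * θ ^ 6 * (3 / 5) ^ k) :=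
      add_le_add hbase (ENNReal.tsum_le_tsum hbad)
    _ = ENNReal.ofReal (1440 * θ ^ 6 + 23040 * θ ^ 6 * (5 / 2)) := by
      have hs : Summable fun k : ℕ => 23040 * θ ^ 6 * (3 / 5 : ℝ) ^ k :=
        (summable_geometric_of_lt_one (by norm_num) (by norm_num)).mul_left _
      rw [← ENNReal.ofReal_tsum_of_nonneg (fun k => by positivity) hs,
        ← ENNReal.ofReal_add (by positivity) (tsum_nonneg fun k => by positivity), tsum_mul_left,
        tsum_geometric_of_lt_one (by norm_num) (by norm_num)]
      norm_num
    _ ≤ ENNReal.ofReal ε := by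
      refine ENNReal.ofReal_le_ofReal ?_
      have : θ ^ 6 ≤ θ := pow_le_of_le_one hθ0.le hθ1 (by norm_num)
      linarith

/-! ### Selecting one favourable window among many -/

/-- By independence the probability is `q ^ N` with `q < 1` the mass of a standard Gaussian below
`R`. It matters that `N` is fixed before the family `e`: the windows are spaced according to `N`. -/
lemma exists_forall_lt_measure_le {R ε : ℝ} (hε : 0 < ε) (hW : IsIsonormal W P) :
    ∃ N : ℕ, 0 < N ∧ ∀ e : Fin N → H, Orthonormal ℝ e →
      P {ω | ∀ n, W (e n) ω < R} ≤ ENNReal.ofReal ε := by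
  set q : ℝ≥0∞ := gaussianReal 0 1 (Iio R) with hq
  have hq1 : q < 1 := by
    have hpos : 0 < gaussianReal 0 1 (Ici R) := by
      refine pos_iff_ne_zero.2 fun h => ?_
      have := gaussianReal_absolutelyContinuous' 0 (v := 1) one_ne_zero h
      simp at this
    have hadd : gaussianReal 0 1 (Iio R) + gaussianReal 0 1 (Ici R) = 1 := by
      rw [← compl_Iio, measure_add_measure_compl measurableSet_Iio, measure_univ]
    rw [← hadd]
    exact ENNReal.lt_add_right (measure_ne_top _ _) hpos.ne'
  have hlim := ENNReal.tendsto_pow_atTop_nhds_zero_of_lt_one hq1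
  obtain ⟨N, hN, hN0⟩ := ((hlim.eventually (gt_mem_nhds (ENNReal.ofReal_pos.2 hε))).and
    (Filter.eventually_gt_atTop 0)).exists
  refine ⟨N, hN0, fun e he => le_trans (le_of_eq ?_) hN.le⟩
  have h := (hW.iIndepFun he).measure_inter_preimage_eq_mul Finset.univ
    (sets := fun _ => Iio R) fun _ _ => measurableSet_Iio
  have hset : {ω | ∀ n, W (e n) ω < R} = ⋂ n ∈ Finset.univ, W (e n) ⁻¹' Iio R := by
    ext ω
    simp
  rw [hset, h]
  have hn : ∀ n, P (W (e n) ⁻¹' Iio R) = q := by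
    intro n
    rw [← Measure.map_apply (hW.measurable _) measurableSet_Iio, hW.map_eq, he.1 n, hq]
    simp
  simp [hn]

/-- Among finitely many Gaussian fields, each having a uniformly positive component along its own
vector of an orthonormal family and almost none along the others, with high probability one is
bounded below by a prescribed level. -/
lemma exists_window (hW : IsIsonormal W P) {C c₀ ε : ℝ} (m : ℝ) (hC : 0 < C) (hc₀ : 0 < c₀)
    (hε : 0 < ε) :
    ∃ N : ℕ, ∃ δ : ℝ, 0 < δ ∧ ∀ (e : Fin N → H) (g : Fin N → ℕ → ℕ → ℕ → H), Orthonormal ℝ e →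
      (∀ n, ‖g n 0 0 0‖ ^ 2 ≤ C) →
      (∀ n k i j, i < 4 ^ (k + 1) → j < 4 ^ (k + 1) →
        ‖g n (k + 1) i j - g n k (i / 4) (j / 4)‖ ^ 2 ≤ C * (1 / 2) ^ k) →
      (∀ n k i j, i < 4 ^ k → j < 4 ^ k → c₀ ≤ inner ℝ (e n) (g n k i j)) →
      (∀ l n k i j, l ≠ n → i < 4 ^ k → j < 4 ^ k → |inner ℝ (e l) (g n k i j)| ≤ δ) →
      P {ω | ∀ n, ∃ k i j, i < 4 ^ k ∧ j < 4 ^ k ∧ W (g n k i j) ω < m}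
        ≤ ENNReal.ofReal ε := by
  have hε3 : 0 < ε / 3 := by positivity
  obtain ⟨K, hK, hgrid⟩ := hW.exists_grid_lower_bound hC hε3
  -- The main component, at least `c₀ * R`, has to pay `K` for the residual and 1 for the cross
  -- terms, and leave `|m|`. Since `K` depends only on `C` and `ε`, there is no circularity in then
  -- choosing `N`, next `Λ`, and finally `δ`.
  set R : ℝ := (|m| + K + 1) / c₀ with hR
  have hRpos : 0 < R := by positivity
  obtain ⟨N, hN0, hN⟩ := hW.exists_forall_lt_measure_le (R := R) hε3
  have hN0' : (0 : ℝ) < N := by exact_mod_cast hN0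
  obtain ⟨Λ, hΛ, hΛε⟩ : ∃ Λ : ℝ, 0 < Λ ∧ N * (1440 * (2 * 1 / Λ ^ 2) ^ 6) ≤ ε / 3 := by
    obtain ⟨θ, hθ0, hθ1, hθε⟩ : ∃ θ : ℝ, 0 < θ ∧ θ ≤ 1 ∧ N * 1440 * θ ≤ ε / 3 := by
      refine ⟨min 1 (ε / 3 / (N * 1440)), by positivity, min_le_left _ _, ?_⟩
      have := min_le_right 1 (ε / 3 / (N * 1440))
      rwa [le_div_iff₀ (by positivity), mul_comm] at this
    refine ⟨√(2 / θ), Real.sqrt_pos.2 (by positivity), ?_⟩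
    rw [Real.sq_sqrt (by positivity)]
    have h1 : 2 * 1 / (2 / θ) = θ := by field_simp
    have : θ ^ 6 ≤ θ := pow_le_of_le_one hθ0.le hθ1 (by norm_num)
    rw [h1, ← mul_assoc]
    exact le_trans (by gcongr) hθε
  refine ⟨N, 1 / (N * Λ), by positivity, fun e g he h0 hstep hdiag hoff => ?_⟩
  -- The projection onto the orthogonal complement of all `e l`. It is a contraction, so the
  -- residual fields satisfy the same chaining hypotheses, and it makes them independent of the `W
  -- (e l)`.
  let Q : H → H := fun φ => φ + ∑ l, (-inner ℝ (e l) φ) • e l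
  have hQe : ∀ φ l, inner ℝ (Q φ) (e l) = 0 := by
    intro φ l
    simp only [Q, inner_add_left, sum_inner, inner_smul_left, orthonormal_iff_ite.1 he]
    simp [real_inner_comm]
  have hQsub : ∀ φ ψ, Q φ - Q ψ = Q (φ - ψ) := by
    intro φ ψ
    simp only [Q, inner_sub_right, neg_sub, sub_smul, Finset.sum_sub_distrib, neg_smul,
      Finset.sum_neg_distrib]
    abel
  have hQnorm : ∀ φ, ‖Q φ‖ ^ 2 ≤ ‖φ‖ ^ 2 := by
    intro φ
    have hdec : φ = Q φ + ∑ l, inner ℝ (e l) φ • e l := by simp [Q]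
    have horth : inner ℝ (Q φ) (∑ l, inner ℝ (e l) φ • e l) = 0 := by
      simp [inner_sum, inner_smul_right, hQe]
    have h := norm_add_sq_eq_norm_sq_add_norm_sq_of_inner_eq_zero (Q φ) _ horth
    rw [← hdec] at h
    nlinarith [mul_self_nonneg ‖∑ l, inner ℝ (e l) φ • e l‖]
  let f : Fin N → ℕ × ℕ × ℕ → H := fun n p => Q (g n p.1 p.2.1 p.2.2)
  let low : Set (ℕ × ℕ × ℕ → ℝ) :=
    {x | ∃ k i j, i < 4 ^ k ∧ j < 4 ^ k ∧ x (k, i, j) < -K}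
  have hlow : MeasurableSet low := by
    have : low = ⋃ k, ⋃ i, ⋃ j, ⋃ (_ : i < 4 ^ k), ⋃ (_ : j < 4 ^ k),
        {x : ℕ × ℕ × ℕ → ℝ | x (k, i, j) < -K} := by
      ext x
      simp only [low, mem_iUnion, mem_ofPred_eq, exists_prop]
    rw [this]
    refine .iUnion fun k => .iUnion fun i => .iUnion fun j => .iUnion fun _ => .iUnion fun _ => ?_
    exact measurableSet_lt (measurable_pi_apply _) measurable_const
  let Bad : Fin N → Set Ω := fun n => (fun ω p => W (f n p) ω) ⁻¹' low
  -- Being the first index above `R` makes these events disjoint, and they involve only the `W (e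
  -- l)`.
  let first : Fin N → Set (Fin N → ℝ) := fun n => {x | (∀ l < n, x l < R) ∧ R ≤ x n}
  have hfirst : ∀ n, MeasurableSet (first n) := by
    intro n
    have : first n = (⋂ l, ⋂ (_ : l < n), {x : Fin N → ℝ | x l < R}) ∩ {x | R ≤ x n} := by
      ext x
      simp [first]
    rw [this]
    refine MeasurableSet.inter (.iInter fun l => .iInter fun _ => ?_)
      (measurableSet_le measurable_const (measurable_pi_apply _))
    exact measurableSet_lt (measurable_pi_apply _) measurable_const
  let ξ : Ω → Fin N → ℝ := fun ω n => W (e n) ω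
  have hξ : Measurable ξ := measurable_pi_lambda _ fun n => hW.measurable _
  have hBad : ∀ n, P (Bad n) ≤ ENNReal.ofReal (ε / 3) := by
    intro n
    refine hgrid (fun k i j => Q (g n k i j)) ((hQnorm _).trans (h0 n)) fun k i j hi hj => ?_
    rw [hQsub]
    exact (hQnorm _).trans (hstep n k i j hi hj)
  have hind : ∀ n, P (Bad n ∩ ξ ⁻¹' first n) = P (Bad n) * P (ξ ⁻¹' first n) := fun n =>
    (hW.indepFun (f n) e fun p l => hQe _ l).measure_inter_preimage_eq_mul _ _ hlow (hfirst n)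
  have hdisj : Pairwise (Function.onFun Disjoint fun n => ξ ⁻¹' first n) := by
    have aux : ∀ n l, n < l → Disjoint (ξ ⁻¹' first n) (ξ ⁻¹' first l) := by
      intro n l hnl
      refine Set.disjoint_left.2 fun ω h1 h2 => ?_
      exact absurd (h2.1 n hnl) (not_lt.2 h1.2)
    intro n l hnl
    rcases lt_or_gt_of_ne hnl with h | h
    · exact aux n l h
    · exact (aux l n h).symm
  -- Independence and disjointness average the bad probabilities over the selected index, so no
  -- factor `N` appears.
  have hsel : P (⋃ n, Bad n ∩ ξ ⁻¹' first n) ≤ ENNReal.ofReal (ε / 3) := by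
    calc P (⋃ n, Bad n ∩ ξ ⁻¹' first n) ≤ ∑' n, P (Bad n ∩ ξ ⁻¹' first n) := measure_iUnion_le _
      _ ≤ ∑' n, ENNReal.ofReal (ε / 3) * P (ξ ⁻¹' first n) := by
        refine ENNReal.tsum_le_tsum fun n => ?_
        rw [hind]
        gcongr
        exact hBad n
      _ = ENNReal.ofReal (ε / 3) * P (⋃ n, ξ ⁻¹' first n) := by
        rw [ENNReal.tsum_mul_left, measure_iUnion hdisj fun n => hξ (hfirst n)]
      _ ≤ ENNReal.ofReal (ε / 3) * 1 := by
        gcongr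
        exact prob_le_one
      _ = _ := mul_one _
  let large : Set Ω := ⋃ n, {ω | Λ ≤ |W (e n) ω|}
  have hlarge : P large ≤ ENNReal.ofReal (ε / 3) := by
    calc P large ≤ ∑ n, P {ω | Λ ≤ |W (e n) ω|} := measure_iUnion_fintype_le _ _
      _ ≤ ∑ _n : Fin N, ENNReal.ofReal (1440 * (2 * 1 / Λ ^ 2) ^ 6) := by
        refine Finset.sum_le_sum fun n _ => hW.measure_le_abs _ one_pos ?_ hΛ
        rw [he.1 n, one_pow]
      _ = ENNReal.ofReal (N * (1440 * (2 * 1 / Λ ^ 2) ^ 6)) := by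
        rw [Finset.sum_const, nsmul_eq_mul, ENNReal.ofReal_mul hN0'.le]
        simp
      _ ≤ _ := ENNReal.ofReal_le_ofReal hΛε
  have hlin : ∀ᵐ ω ∂P, ∀ n k i j, W (Q (g n k i j)) ω
      = W (g n k i j) ω + ∑ l, (-inner ℝ (e l) (g n k i j)) * W (e l) ω := by
    simp only [ae_all_iff]
    exact fun n k i j => hW.add_sum_ae _ _ _ _
  have hsub : {ω | ∀ n, ∃ k i j, i < 4 ^ k ∧ j < 4 ^ k ∧ W (g n k i j) ω < m} ≤ᵐ[P]
      (({ω | ∀ n, W (e n) ω < R} ∪ ⋃ n, Bad n ∩ ξ ⁻¹' first n) ∪ large : Set Ω) := by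
    filter_upwards [hlin] with ω hω hall
    by_contra hcon
    have hcon' : ω ∉ (({ω | ∀ n, W (e n) ω < R} ∪ ⋃ n, Bad n ∩ ξ ⁻¹' first n) ∪ large : Set Ω) :=
      hcon
    simp only [mem_union, not_or, mem_iUnion, not_exists, large] at hcon'
    obtain ⟨⟨hex, hsel'⟩, hΛ'⟩ := hcon'
    have hex' : ∃ n, R ≤ W (e n) ω := by
      by_contra h
      exact hex fun n => lt_of_not_ge fun h' => h ⟨n, h'⟩
    obtain ⟨n, hn, hmin⟩ : ∃ n, R ≤ W (e n) ω ∧ ∀ l < n, W (e l) ω < R := by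
      classical
      obtain ⟨n, hn⟩ := WellFounded.has_min (wellFounded_lt (α := Fin N))
        {n | R ≤ W (e n) ω} hex'
      exact ⟨n, hn.1, fun l hl => lt_of_not_ge fun h => hn.2 l h hl⟩
    have hnb : ω ∉ Bad n := fun h => hsel' n ⟨h, hmin, hn⟩
    obtain ⟨k, i, j, hi, hj, hlt⟩ := hall n
    have hQ : -K ≤ W (Q (g n k i j)) ω := by
      by_contra h
      exact hnb ⟨k, i, j, hi, hj, lt_of_not_ge h⟩
    rw [hω, ← Finset.add_sum_erase _ _ (Finset.mem_univ n)] at hQ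
    have hrest : ∑ l ∈ Finset.univ.erase n, (-inner ℝ (e l) (g n k i j)) * W (e l) ω ≤ 1 := by
      have hle : ∀ l ∈ Finset.univ.erase n,
          (-inner ℝ (e l) (g n k i j)) * W (e l) ω ≤ 1 / (N : ℝ) := by
        intro l hl
        have h1 := hoff l n k i j (Finset.ne_of_mem_erase hl) hi hj
        have h2 : |W (e l) ω| ≤ Λ := (not_le.1 (hΛ' l)).le
        have h3 : |(-inner ℝ (e l) (g n k i j)) * W (e l) ω| ≤ 1 / (N * Λ) * Λ := by
          rw [abs_mul, abs_neg]
          gcongr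
        have h4 : 1 / (N * Λ) * Λ = 1 / N := by field_simp
        rw [h4] at h3
        exact (le_abs_self _).trans h3
      calc ∑ l ∈ Finset.univ.erase n, (-inner ℝ (e l) (g n k i j)) * W (e l) ω
          ≤ ∑ l ∈ Finset.univ.erase n, 1 / (N : ℝ) := Finset.sum_le_sum hle
        _ ≤ ∑ l : Fin N, 1 / (N : ℝ) :=
          Finset.sum_le_sum_of_subset_of_nonneg (Finset.erase_subset _ _)
            fun _ _ _ => by positivity
        _ = 1 := by
          simp
          field_simp
    have hmain : |m| + K + 1 ≤ inner ℝ (e n) (g n k i j) * W (e n) ω := by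
      calc |m| + K + 1 = c₀ * R := by
            rw [hR]
            field_simp
        _ ≤ _ := mul_le_mul (hdiag n k i j hi hj) hn hRpos.le
          (hc₀.le.trans (hdiag n k i j hi hj))
    have := le_abs_self m
    linarith
  calc P _ ≤ P (({ω | ∀ n, W (e n) ω < R} ∪ ⋃ n, Bad n ∩ ξ ⁻¹' first n) ∪ large : Set Ω) :=
        measure_mono_ae hsub
    _ ≤ ENNReal.ofReal (ε / 3) + ENNReal.ofReal (ε / 3) + ENNReal.ofReal (ε / 3) :=
      (measure_union_le _ _).trans
        (add_le_add ((measure_union_le _ _).trans (add_le_add (hN e he) hsel)) hlarge)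
    _ = ENNReal.ofReal ε := by
      rw [← ENNReal.ofReal_add hε3.le hε3.le, ← ENNReal.ofReal_add (by positivity) hε3.le]
      congr 1
      ring

end IsIsonormal

end StochasticHeat

noncomputable section

namespace StochasticHeat

/-! ### Covariance and increments of the stochastic convolution -/

lemma heatKernel_nonneg (t x y : ℝ) : 0 ≤ heatKernel t x y := by
  unfold heatKernel
  positivity

lemma heatKernel_self (t x : ℝ) : heatKernel t x x = (√(4 * Real.pi * t))⁻¹ := by
  simp [heatKernel]

/-- The semigroup property: completing the square in `z` about `(b * x + a * y) / (a + b)` leaves a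
Gaussian integral. -/
lemma integral_heatKernel_mul {a b : ℝ} (ha : 0 < a) (hb : 0 < b) (x y : ℝ) :
    ∫ z, heatKernel a x z * heatKernel b y z = heatKernel (a + b) x y := by
  have h : ∀ z, heatKernel a x z * heatKernel b y z
      = (√(4 * Real.pi * a))⁻¹ * (√(4 * Real.pi * b))⁻¹ *
        Real.exp (-(x - y) ^ 2 / (4 * (a + b))) *
        Real.exp (-((a + b) / (4 * a * b)) * (z - (b * x + a * y) / (a + b)) ^ 2) := by
    intro z
    rw [mul_assoc _ (Real.exp _), ← Real.exp_add]
    unfold heatKernel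
    rw [mul_mul_mul_comm, ← Real.exp_add]
    congr 2
    field_simp
    ring
  simp_rw [h]
  rw [integral_const_mul, integral_sub_right_eq_self
    (fun z => Real.exp (-((a + b) / (4 * a * b)) * z ^ 2)), integral_gaussian]
  unfold heatKernel
  have hs : Real.pi / ((a + b) / (4 * a * b))
      = (4 * Real.pi * a) * (4 * Real.pi * b) / (4 * Real.pi * (a + b)) := by
    field_simp
  have hp := Real.pi_pos
  have h1 : 0 < √(4 * Real.pi * a) := Real.sqrt_pos.2 (by positivity)
  have h2 : 0 < √(4 * Real.pi * b) := Real.sqrt_pos.2 (by positivity)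
  rw [hs, Real.sqrt_div (by positivity),
    Real.sqrt_mul (show 0 ≤ 4 * Real.pi * a by positivity)]
  generalize √(4 * Real.pi * a) = A at *
  generalize √(4 * Real.pi * b) = B at *
  field_simp

/-- The element of `L²` whose Wiener integral is the stochastic convolution at `(t, x)`. -/
def convLp (t x : ℝ) : Lp ℝ 2 spaceTime := (memLp_convKernel t x).toLp (convKernel t x)

/-- Integrating in space first, the semigroup property turns each time slice into a single kernel of
time `(t - r) + (s - r)`. -/
lemma inner_convLp {s t : ℝ} (hst : s ≤ t) (x y : ℝ) :
    IntegrableOn (fun r => heatKernel (t + s - 2 * r) x y) (Ioo 0 s) ∧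
    inner ℝ (convLp t x) (convLp s y) = ∫ r in Ioo 0 s, heatKernel (t + s - 2 * r) x y := by
  have hint : Integrable (fun p => convKernel t x p * convKernel s y p) spaceTime :=
    (memLp_convKernel t x).integrable_mul (memLp_convKernel s y)
  have hslice : (fun r => ∫ z, convKernel t x (r, z) * convKernel s y (r, z))
      = (Ioo 0 s).indicator fun r => heatKernel (t + s - 2 * r) x y := by
    funext r
    by_cases hr : r ∈ Ioo 0 s
    · rw [indicator_of_mem hr, show t + s - 2 * r = (t - r) + (s - r) by ring,
        ← integral_heatKernel_mul (sub_pos.2 (hr.2.trans_le hst)) (sub_pos.2 hr.2)]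
      simp [convKernel, hr.1, hr.2, hr.2.trans_le hst]
    · rw [indicator_of_notMem hr]
      have : ∀ z, convKernel s y (r, z) = 0 := fun z =>
        indicator_of_notMem (fun h => hr h.1) _
      simp [this]
  have hsub : Ioo 0 s ⊆ Ici 0 := fun r hr => hr.1.le
  constructor
  · have h := hint.integral_prod_left
    rw [hslice, integrable_indicator_iff measurableSet_Ioo, IntegrableOn,
      Measure.restrict_restrict measurableSet_Ioo, inter_eq_self_of_subset_left hsub] at h
    exact h
  · have h1 : inner ℝ (convLp t x) (convLp s y)
        = ∫ p, convKernel t x p * convKernel s y p ∂spaceTime := by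
      rw [L2.inner_def]
      refine integral_congr_ae ?_
      filter_upwards [(memLp_convKernel t x).coeFn_toLp, (memLp_convKernel s y).coeFn_toLp]
        with p h1 h2
      simp only [convLp, h1, h2]
      simp [mul_comm]
    rw [h1, spaceTime, integral_prod _ hint, hslice, setIntegral_indicator measurableSet_Ioo,
      inter_eq_self_of_subset_right hsub]

lemma heatKernel_self_eq_rpow {v : ℝ} (hv : 0 < v) (x : ℝ) :
    heatKernel v x x = (√(4 * Real.pi))⁻¹ * v ^ (-(1 / 2) : ℝ) := by
  rw [heatKernel_self, Real.sqrt_mul (by positivity), mul_inv, Real.rpow_neg hv.le,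
    ← Real.sqrt_eq_rpow]

lemma integral_heatKernel_self {a s : ℝ} (hs : 0 ≤ s) (has : 2 * s ≤ a) (x : ℝ) :
    ∫ r in Ioo 0 s, heatKernel (a - 2 * r) x x = (√(4 * Real.pi))⁻¹ * (√a - √(a - 2 * s)) := by
  have h1 : ∫ r in Ioo 0 s, heatKernel (a - 2 * r) x x
      = ∫ r in Ioo 0 s, (√(4 * Real.pi))⁻¹ * (a - 2 * r) ^ (-(1 / 2) : ℝ) := by
    refine setIntegral_congr_fun measurableSet_Ioo fun r hr => ?_
    exact heatKernel_self_eq_rpow (by linarith [hr.2]) x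
  rw [h1, integral_const_mul, ← integral_Ioc_eq_integral_Ioo, ← intervalIntegral.integral_of_le hs,
    intervalIntegral.integral_comp_sub_mul (fun v => v ^ (-(1 / 2) : ℝ)) two_ne_zero,
    integral_rpow (Or.inl (by norm_num))]
  congr 1
  rw [show (-(1 / 2) + 1 : ℝ) = 1 / 2 by norm_num, ← Real.sqrt_eq_rpow, ← Real.sqrt_eq_rpow]
  simp only [smul_eq_mul, mul_zero, sub_zero]
  ring

lemma inv_sqrt_four_pi_le : (√(4 * Real.pi))⁻¹ ≤ 1 / 2 := by
  rw [inv_le_comm₀ (Real.sqrt_pos.2 (by positivity)) (by norm_num)]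
  refine Real.le_sqrt_of_sq_le ?_
  have := Real.pi_gt_three
  norm_num
  linarith

lemma norm_convLp_sq_le {t : ℝ} (ht : 0 ≤ t) (x : ℝ) : ‖convLp t x‖ ^ 2 ≤ √(2 * t) := by
  rw [← real_inner_self_eq_norm_sq, (inner_convLp le_rfl x x).2,
    integral_heatKernel_self ht (by linarith), show t + t - 2 * t = 0 by ring, Real.sqrt_zero,
    sub_zero, show t + t = 2 * t by ring]
  have := inv_sqrt_four_pi_le
  have := Real.sqrt_nonneg (2 * t)
  nlinarith

lemma norm_convLp_sub_time_le {s t : ℝ} (hs : 0 ≤ s) (hst : s ≤ t) (x : ℝ) :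
    ‖convLp t x - convLp s x‖ ^ 2 ≤ √(t - s) := by
  rw [norm_sub_sq_real, ← real_inner_self_eq_norm_sq, ← real_inner_self_eq_norm_sq,
    (inner_convLp le_rfl x x).2, (inner_convLp le_rfl x x).2, (inner_convLp hst x x).2,
    integral_heatKernel_self (hs.trans hst) (by linarith), integral_heatKernel_self hs (by linarith),
    integral_heatKernel_self hs (by linarith), show t + t - 2 * t = 0 by ring,
    show s + s - 2 * s = 0 by ring, show t + s - 2 * s = t - s by ring, Real.sqrt_zero]
  have h0 := inv_sqrt_four_pi_le
  have h0' : 0 ≤ (√(4 * Real.pi))⁻¹ := by positivity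
  have h1 := Real.sqrt_nonneg (t - s)
  -- Concavity of the square root: the variance terms are absorbed by the covariance, and only the
  -- `√(t - s)` term survives.
  have h2 : √(t + t) + √(s + s) ≤ 2 * √(t + s) := by
    have e1 := Real.sq_sqrt (show 0 ≤ t + t by linarith)
    have e2 := Real.sq_sqrt (show 0 ≤ s + s by linarith)
    have e3 := Real.sq_sqrt (show 0 ≤ t + s by linarith)
    refine abs_le_of_sq_le_sq' ?_ (by positivity) |>.2
    nlinarith [sq_nonneg (√(t + t) - √(s + s))]
  nlinarith

lemma one_sub_exp_neg_le_rpow {w : ℝ} (hw : 0 ≤ w) : 1 - Real.exp (-w) ≤ w ^ (1 / 4 : ℝ) := by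
  rcases le_total w 1 with h | h
  · have h1 := Real.one_sub_le_exp_neg w
    have h2 : w ^ (1 : ℝ) ≤ w ^ (1 / 4 : ℝ) :=
      Real.rpow_le_rpow_of_exponent_ge' hw h (by norm_num) (by norm_num)
    rw [Real.rpow_one] at h2
    linarith
  · have h1 := Real.one_le_rpow h (show (0 : ℝ) ≤ 1 / 4 by norm_num)
    have := Real.exp_pos (-w)
    linarith

/-- Bounding `1 - exp (-w)` by `w ^ (1 / 4)` trades a factor `√|x - y|` for the singularity `v ^ (-3
/ 4)`, which is still integrable at 0. This spatial exponent is not sharp, but it matches the one in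
time, so one square grid serves both variables. -/
lemma heatKernel_self_sub_le {v : ℝ} (hv : 0 < v) (x y : ℝ) :
    heatKernel v x x - heatKernel v x y ≤ √|x - y| * v ^ (-(3 / 4) : ℝ) := by
  have h1 : heatKernel v x x - heatKernel v x y
      = (√(4 * Real.pi))⁻¹ * v ^ (-(1 / 2) : ℝ) * (1 - Real.exp (-((x - y) ^ 2 / (4 * v)))) := by
    rw [heatKernel_self_eq_rpow hv]
    have h2 : heatKernel v x y = heatKernel v x x * Real.exp (-((x - y) ^ 2 / (4 * v))) := by
      rw [heatKernel_self, heatKernel, neg_div]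
    rw [h2, heatKernel_self_eq_rpow hv]
    ring
  have h3 : ((x - y) ^ 2 / (4 * v)) ^ (1 / 4 : ℝ) ≤ √|x - y| * v ^ (-(1 / 4) : ℝ) := by
    calc ((x - y) ^ 2 / (4 * v)) ^ (1 / 4 : ℝ) ≤ (|x - y| ^ 2 * v⁻¹) ^ (1 / 4 : ℝ) := by
          refine Real.rpow_le_rpow (by positivity) ?_ (by norm_num)
          rw [sq_abs, ← div_eq_mul_inv]
          exact div_le_div_of_nonneg_left (sq_nonneg _) hv (by linarith)
      _ = √|x - y| * v ^ (-(1 / 4) : ℝ) := by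
        rw [Real.mul_rpow (by positivity) (by positivity), ← Real.rpow_natCast,
          ← Real.rpow_mul (abs_nonneg _), Real.sqrt_eq_rpow, Real.inv_rpow hv.le,
          Real.rpow_neg hv.le]
        norm_num
  have h4 := one_sub_exp_neg_le_rpow (show 0 ≤ (x - y) ^ 2 / (4 * v) by positivity)
  have h5 : v ^ (-(3 / 4) : ℝ) = v ^ (-(1 / 2) : ℝ) * v ^ (-(1 / 4) : ℝ) := by
    rw [← Real.rpow_add hv]
    norm_num
  have h6 := inv_sqrt_four_pi_le
  rw [h1, h5]
  calc (√(4 * Real.pi))⁻¹ * v ^ (-(1 / 2) : ℝ) * (1 - Real.exp (-((x - y) ^ 2 / (4 * v))))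
      ≤ (√(4 * Real.pi))⁻¹ * v ^ (-(1 / 2) : ℝ) * (√|x - y| * v ^ (-(1 / 4) : ℝ)) := by
        gcongr
        exact h4.trans h3
    _ ≤ 1 * v ^ (-(1 / 2) : ℝ) * (√|x - y| * v ^ (-(1 / 4) : ℝ)) := by
        gcongr
        linarith
    _ = _ := by ring

lemma norm_convLp_sub_space_le {t : ℝ} (ht : 0 ≤ t) (ht3 : t ≤ 3) (x y : ℝ) :
    ‖convLp t x - convLp t y‖ ^ 2 ≤ 8 * √|x - y| := by
  have hx := inner_convLp (le_refl t) x x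
  have hy := inner_convLp (le_refl t) y y
  have hxy := inner_convLp (le_refl t) x y
  have hyx : ∫ r in Ioo 0 t, heatKernel (t + t - 2 * r) y y
      = ∫ r in Ioo 0 t, heatKernel (t + t - 2 * r) x x := by
    simp_rw [heatKernel_self]
  have hpow : IntervalIntegrable (fun r : ℝ => √|x - y| * (t + t - 2 * r) ^ (-(3 / 4) : ℝ))
      volume 0 t := by
    have h := ((intervalIntegral.intervalIntegrable_rpow' (a := 0) (b := 2 * t)
      (r := (-(3 / 4) : ℝ)) (by norm_num)).comp_mul_left (c := 2)).comp_sub_left t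
    rw [zero_div, sub_zero, mul_div_cancel_left₀ _ two_ne_zero, sub_self] at h
    convert h.symm.const_mul √|x - y| using 4
    ring
  have hle : ∫ r in Ioo 0 t, (heatKernel (t + t - 2 * r) x x - heatKernel (t + t - 2 * r) x y)
      ≤ ∫ r in Ioo 0 t, √|x - y| * (t + t - 2 * r) ^ (-(3 / 4) : ℝ) := by
    refine setIntegral_mono_on (hx.1.sub hxy.1)
      ((intervalIntegrable_iff_integrableOn_Ioo_of_le ht).1 hpow) measurableSet_Ioo fun r hr => ?_
    exact heatKernel_self_sub_le (by linarith [hr.2]) x y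
  have hval : ∫ r in Ioo 0 t, √|x - y| * (t + t - 2 * r) ^ (-(3 / 4) : ℝ)
      = √|x - y| * (2 * (2 * t) ^ (1 / 4 : ℝ)) := by
    rw [integral_const_mul, ← integral_Ioc_eq_integral_Ioo, ← intervalIntegral.integral_of_le ht,
      intervalIntegral.integral_comp_sub_mul (fun v => v ^ (-(3 / 4) : ℝ)) two_ne_zero,
      integral_rpow (Or.inl (by norm_num)), show (-(3 / 4) + 1 : ℝ) = 1 / 4 by norm_num,
      show t + t - 2 * t = 0 by ring, Real.zero_rpow (by norm_num),
      show t + t - 2 * 0 = 2 * t by ring, smul_eq_mul]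
    ring
  have h16 : (2 * t) ^ (1 / 4 : ℝ) ≤ 2 := by
    calc (2 * t) ^ (1 / 4 : ℝ) ≤ (16 : ℝ) ^ (1 / 4 : ℝ) :=
          Real.rpow_le_rpow (by linarith) (by linarith) (by norm_num)
      _ = 2 := by
        rw [show (16 : ℝ) = 2 ^ (4 : ℝ) by norm_num, ← Real.rpow_mul (by norm_num)]
        norm_num
  rw [norm_sub_sq_real, ← real_inner_self_eq_norm_sq, ← real_inner_self_eq_norm_sq, hx.2, hy.2,
    hxy.2, hyx]
  rw [integral_sub hx.1 hxy.1, hval] at hle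
  have := Real.sqrt_nonneg |x - y|
  nlinarith

lemma norm_convLp_sub_le {s t : ℝ} (hs : 0 ≤ s) (hs3 : s ≤ 3) (ht : 0 ≤ t)
    (x y : ℝ) : ‖convLp t x - convLp s y‖ ^ 2 ≤ 16 * (√|t - s| + √|x - y|) := by
  have h1 : ‖convLp t x - convLp s x‖ ^ 2 ≤ √|t - s| := by
    rcases le_total s t with h | h
    · rw [abs_of_nonneg (sub_nonneg.2 h)]
      exact norm_convLp_sub_time_le hs h x
    · rw [abs_sub_comm, abs_of_nonneg (sub_nonneg.2 h), norm_sub_rev]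
      exact norm_convLp_sub_time_le ht h x
  have h2 := norm_convLp_sub_space_le hs hs3 x y
  have h3 := norm_sub_le_norm_sub_add_norm_sub (convLp t x) (convLp s x) (convLp s y)
  have h4 := norm_nonneg (convLp t x - convLp s y)
  have h5 := Real.sqrt_nonneg |t - s|
  have h6 : ‖convLp t x - convLp s y‖ ^ 2
      ≤ (‖convLp t x - convLp s x‖ + ‖convLp s x - convLp s y‖) ^ 2 := by gcongr
  nlinarith [sq_nonneg (‖convLp t x - convLp s x‖ - ‖convLp s x - convLp s y‖)]

/-! ### Components of the convolution along unit boxes -/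

/-- The unit box `(0, 1) × (a, a + 1)` of space-time. -/
def unitBox (a : ℝ) : Set (ℝ × ℝ) := Ioo 0 1 ×ˢ Ioo a (a + 1)

lemma measurableSet_unitBox (a : ℝ) : MeasurableSet (unitBox a) :=
  measurableSet_Ioo.prod measurableSet_Ioo

lemma spaceTime_unitBox (a : ℝ) : spaceTime (unitBox a) = 1 := by
  rw [spaceTime, unitBox, Measure.prod_prod, Measure.restrict_apply measurableSet_Ioo,
    inter_eq_self_of_subset_left fun r hr => hr.1.le]
  simp

/-- The normalized indicator of a unit box. -/
def unitBoxLp (a : ℝ) : Lp ℝ 2 spaceTime :=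
  indicatorConstLp 2 (measurableSet_unitBox a) (by simp [spaceTime_unitBox]) 1

lemma orthonormal_unitBoxLp {ι : Type*} {a : ι → ℝ} (ha : ∀ i j, i ≠ j → 1 ≤ |a i - a j|) :
    Orthonormal ℝ fun i => unitBoxLp (a i) := by
  classical
  rw [orthonormal_iff_ite]
  intro i j
  rw [unitBoxLp, unitBoxLp, L2.real_inner_indicatorConstLp_one_indicatorConstLp_one _ _
    (by simp [spaceTime_unitBox]) (by simp [spaceTime_unitBox])]
  split_ifs with h
  · rw [h, inter_self, measureReal_def, spaceTime_unitBox, ENNReal.toReal_one]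
  · have hempty : unitBox (a i) ∩ unitBox (a j) = ∅ := by
      refine Set.eq_empty_of_forall_notMem fun p hp => ?_
      have h1 := hp.1.2
      have h2 := hp.2.2
      rcases le_abs.1 (ha i j h) with h3 | h3
      · linarith [h1.1, h2.2]
      · linarith [h1.2, h2.1]
    simp [hempty]

lemma inner_unitBoxLp_convLp (a : ℝ) {t : ℝ} (ht : 1 ≤ t) (x : ℝ) :
    IntegrableOn (fun p => heatKernel (t - p.1) x p.2) (unitBox a) spaceTime ∧
    inner ℝ (unitBoxLp a) (convLp t x)
      = ∫ p in unitBox a, heatKernel (t - p.1) x p.2 ∂spaceTime := by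
  have hne : spaceTime (unitBox a) ≠ ∞ := by simp [spaceTime_unitBox]
  have hcongr : ∀ᵐ p ∂spaceTime.restrict (unitBox a),
      (convLp t x : ℝ × ℝ → ℝ) p = heatKernel (t - p.1) x p.2 := by
    filter_upwards [ae_restrict_of_ae (memLp_convKernel t x).coeFn_toLp,
      ae_restrict_mem (measurableSet_unitBox a)] with p hp hmem
    rw [convLp, hp, convKernel, indicator_of_mem]
    exact ⟨⟨hmem.1.1, hmem.1.2.trans_le ht⟩, mem_univ _⟩
  constructor
  · exact (integrableOn_Lp_of_measure_ne_top (convLp t x) fact_one_le_two_ennreal.elim hne).congr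
      hcongr
  · rw [unitBoxLp, L2.inner_indicatorConstLp_one]
    exact integral_congr_ae hcongr

/-- The box lies in times (0, 1) and the window in times [2, 3], so the kernel is evaluated at times
between 1 and 3 and distances at most 1, where it is bounded below. -/
lemma le_inner_unitBoxLp_convLp {a t x : ℝ} (ht : 2 ≤ t) (ht3 : t ≤ 3) (hx : a ≤ x)
    (hx1 : x ≤ a + 1) :
    (√(12 * Real.pi))⁻¹ * Real.exp (-1) ≤ inner ℝ (unitBoxLp a) (convLp t x) := by
  obtain ⟨hint, heq⟩ := inner_unitBoxLp_convLp a (by linarith : 1 ≤ t) x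
  rw [heq]
  refine le_trans (le_of_eq ?_) (setIntegral_ge_of_const_le_real
    (c := (√(12 * Real.pi))⁻¹ * Real.exp (-1)) (measurableSet_unitBox a)
    (by simp [spaceTime_unitBox]) (fun p hp => ?_) hint)
  · rw [measureReal_def, spaceTime_unitBox, ENNReal.toReal_one, mul_one]
  · have h1 := hp.1
    have h2 := hp.2
    have hpi := Real.pi_pos
    have hv : 1 ≤ t - p.1 := by linarith [h1.2]
    have hv3 : t - p.1 ≤ 3 := by linarith [h1.1]
    unfold heatKernel
    refine mul_le_mul ?_ (Real.exp_le_exp.2 ?_) (Real.exp_pos _).le (by positivity)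
    · refine inv_anti₀ (Real.sqrt_pos.2 (by positivity)) (Real.sqrt_le_sqrt ?_)
      nlinarith
    · rw [neg_div, neg_le_neg_iff, div_le_one (by linarith)]
      have : (x - p.2) ^ 2 ≤ 1 := by
        rw [sq_le_one_iff_abs_le_one, abs_le]
        constructor <;> linarith [h2.1, h2.2]
      linarith

/-- The Gaussian decay is weakened to `12 / d ^ 2`, which is all that is needed to make cross terms
small by spacing the windows. -/
lemma abs_inner_unitBoxLp_convLp_le {a t x d : ℝ} (ht : 2 ≤ t) (ht3 : t ≤ 3) (hd : 0 < d)
    (hx : ∀ y ∈ Ioo a (a + 1), d ≤ |x - y|) :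
    |inner ℝ (unitBoxLp a) (convLp t x)| ≤ 12 / d ^ 2 := by
  rw [(inner_unitBoxLp_convLp a (by linarith : 1 ≤ t) x).2, ← Real.norm_eq_abs]
  refine le_trans (norm_setIntegral_le_of_norm_le_const (C := 12 / d ^ 2)
    (by simp [spaceTime_unitBox]) fun p hp => ?_)
    (le_of_eq (by rw [measureReal_def, spaceTime_unitBox]; simp))
  have h1 := hp.1
  have hpi := Real.pi_gt_three
  have hv : 1 ≤ t - p.1 := by linarith [h1.2]
  have hv3 : t - p.1 ≤ 3 := by linarith [h1.1]
  rw [Real.norm_of_nonneg (heatKernel_nonneg _ _ _)]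
  have hdd : d ^ 2 ≤ (x - p.2) ^ 2 := by
    rw [← sq_abs (x - p.2)]
    exact pow_le_pow_left₀ hd.le (hx p.2 hp.2) 2
  have hexp : Real.exp (-(x - p.2) ^ 2 / (4 * (t - p.1))) ≤ 12 / d ^ 2 := by
    rw [neg_div, Real.exp_neg, ← inv_div (d ^ 2) 12]
    refine inv_anti₀ (by positivity) ?_
    calc d ^ 2 / 12 ≤ (x - p.2) ^ 2 / (4 * (t - p.1)) :=
          div_le_div₀ (sq_nonneg _) hdd (by linarith) (by linarith)
      _ ≤ Real.exp ((x - p.2) ^ 2 / (4 * (t - p.1))) := by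
        linarith [Real.add_one_le_exp ((x - p.2) ^ 2 / (4 * (t - p.1)))]
  have hone : (√(4 * Real.pi * (t - p.1)))⁻¹ ≤ 1 := by
    refine inv_le_one_of_one_le₀ (Real.one_le_sqrt.2 ?_)
    nlinarith
  calc heatKernel (t - p.1) x p.2
      ≤ 1 * Real.exp (-(x - p.2) ^ 2 / (4 * (t - p.1))) :=
        mul_le_mul_of_nonneg_right hone (Real.exp_pos _).le
    _ ≤ 12 / d ^ 2 := by rw [one_mul]; exact hexp

/-! ### The grid of a window and the favourable event -/

lemma abs_grid_sub_parent_le (i k : ℕ) :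
    |(i : ℝ) / 4 ^ (k + 1) - ((i / 4 : ℕ) : ℝ) / 4 ^ k| ≤ (1 / 4) ^ k := by
  have h1 : (i : ℝ) = 4 * ((i / 4 : ℕ) : ℝ) + ((i % 4 : ℕ) : ℝ) := by
    exact_mod_cast (Nat.div_add_mod i 4).symm
  have h2 : ((i % 4 : ℕ) : ℝ) ≤ 4 := by exact_mod_cast (Nat.mod_lt i (by norm_num)).le
  have h3 : (i : ℝ) / 4 ^ (k + 1) - ((i / 4 : ℕ) : ℝ) / 4 ^ k
      = ((i % 4 : ℕ) : ℝ) / 4 * (1 / 4) ^ k := by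
    rw [h1, pow_succ, one_div, inv_pow]
    field_simp
    ring
  rw [h3, abs_of_nonneg (by positivity)]
  exact mul_le_of_le_one_left (by positivity) (by linarith)

/-- This is why the grid is quaternary: variances grow like the square root of the distance, so mesh
`4 ^ (-k)` yields the decay `2 ^ (-k)` required by the chaining. -/
lemma sqrt_le_half_pow {d : ℝ} {k : ℕ} (hd : d ≤ (1 / 4) ^ k) : √d ≤ (1 / 2) ^ k := by
  refine Real.sqrt_le_iff.2 ⟨by positivity, hd.trans (le_of_eq ?_)⟩
  rw [← pow_mul, mul_comm, pow_mul]
  norm_num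

lemma natCast_div_four_pow_lt {i k : ℕ} (hi : i < 4 ^ k) : (i : ℝ) / 4 ^ k < 1 := by
  rw [div_lt_one (by positivity)]
  exact_mod_cast hi

variable {Ω : Type*} {mΩ : MeasurableSpace Ω} {P : Measure Ω} {ℱ : Filtration ℝ≥0 mΩ}
  {W : Lp ℝ 2 spaceTime → Ω → ℝ}

lemma IsWhiteNoise.isIsonormal (hW : IsWhiteNoise W ℱ P) : IsIsonormal W P :=
  ⟨hW.measurable, hW.gaussian, hW.centered, hW.covariance⟩

/-- The event that the stochastic convolution is at least `m` on the grid of the window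
`[2, 3) × [a, a + 1)`. -/
def gridEvent (W : Lp ℝ 2 spaceTime → Ω → ℝ) (m a : ℝ) : Set Ω :=
  {ω | ∀ k i j : ℕ, i < 4 ^ k → j < 4 ^ k → m ≤ W (convLp (2 + i / 4 ^ k) (a + j / 4 ^ k)) ω}

lemma measurableSet_gridEvent (hW : IsIsonormal W P) (m a : ℝ) :
    MeasurableSet (gridEvent W m a) := by
  simp only [gridEvent, ofPred_forall]
  refine .iInter fun k => .iInter fun i => .iInter fun j => .iInter fun _ => .iInter fun _ => ?_
  exact measurableSet_le measurable_const (hW.measurable _)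

variable [IsProbabilityMeasure P]

/-- With high probability the stochastic convolution is large throughout some window. -/
lemma exists_gridEvent (hW : IsIsonormal W P) (m : ℝ) {ε : ℝ} (hε : 0 < ε) :
    ∃ N : ℕ, ∃ a : Fin N → ℝ, P (⋃ n, gridEvent W m (a n))ᶜ ≤ ENNReal.ofReal ε := by
  obtain ⟨N, δ, hδ, h⟩ := hW.exists_window (C := 32) (c₀ := (√(12 * Real.pi))⁻¹ * Real.exp (-1)) m
    (by norm_num) (by positivity) hε
  -- Makes the cross-term bound `12 / d ^ 2` equal to `δ`. Left endpoints at least `d + 1` apart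
  -- leave gaps at least `d` between the unit intervals.
  set d : ℝ := √(12 / δ) with hd
  have hdpos : 0 < d := Real.sqrt_pos.2 (by positivity)
  have hdδ : 12 / d ^ 2 = δ := by
    rw [hd, Real.sq_sqrt (by positivity)]
    field_simp
  let a : Fin N → ℝ := fun n => (d + 1) * n
  have ha : ∀ l n, l ≠ n → d + 1 ≤ |a l - a n| := by
    intro l n hln
    have h1 : (1 : ℝ) ≤ |((l : ℕ) : ℝ) - ((n : ℕ) : ℝ)| := by
      have h2 : (1 : ℤ) ≤ |((l : ℕ) : ℤ) - ((n : ℕ) : ℤ)| :=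
        Int.one_le_abs (sub_ne_zero.2 fun h => hln (Fin.ext (by exact_mod_cast h)))
      exact_mod_cast h2
    simp only [a]
    rw [← mul_sub, abs_mul, abs_of_pos (by linarith)]
    exact le_mul_of_one_le_right (by linarith) h1
  refine ⟨N, a, ?_⟩
  refine le_trans (measure_mono fun ω hω => ?_) (h (fun n => unitBoxLp (a n))
    (fun n k i j => convLp (2 + i / 4 ^ k) (a n + j / 4 ^ k)) (orthonormal_unitBoxLp fun l n hln =>
      le_trans (by linarith) (ha l n hln)) ?_ ?_ ?_ ?_)
  · intro n
    by_contra hcon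
    refine hω (mem_iUnion.2 ⟨n, fun k i j hi hj => ?_⟩)
    by_contra hlt
    exact hcon ⟨k, i, j, hi, hj, lt_of_not_ge hlt⟩
  · intro n
    refine (norm_convLp_sq_le (by simp) _).trans ?_
    simp only [Nat.cast_zero, zero_div, add_zero]
    rw [Real.sqrt_le_iff]
    norm_num
  · intro n k i j hi hj
    have h1 := natCast_div_four_pow_lt hi
    have h2 : ((i / 4 : ℕ) : ℝ) / 4 ^ k < 1 :=
      natCast_div_four_pow_lt (by rw [pow_succ] at hi; omega)
    refine (norm_convLp_sub_le (by positivity) (by linarith) (by positivity) _ _).trans ?_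
    have h3 := sqrt_le_half_pow (abs_grid_sub_parent_le i k)
    have h4 := sqrt_le_half_pow (abs_grid_sub_parent_le j k)
    rw [add_sub_add_left_eq_sub, add_sub_add_left_eq_sub]
    linarith
  · intro n k i j hi hj
    have h1 := natCast_div_four_pow_lt hi
    have h2 := natCast_div_four_pow_lt hj
    have h3 : 0 ≤ (i : ℝ) / 4 ^ k := by positivity
    have h4 : 0 ≤ (j : ℝ) / 4 ^ k := by positivity
    exact le_inner_unitBoxLp_convLp (by linarith) (by linarith) (by linarith) (by linarith)
  · intro l n k i j hln hi hj
    have h1 := natCast_div_four_pow_lt hi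
    have h2 := natCast_div_four_pow_lt hj
    have h3 : 0 ≤ (i : ℝ) / 4 ^ k := by positivity
    have h4 : 0 ≤ (j : ℝ) / 4 ^ k := by positivity
    rw [← hdδ]
    refine abs_inner_unitBoxLp_convLp_le (by linarith) (by linarith) hdpos fun y hy => ?_
    have h5 := ha l n hln
    rcases le_abs.1 h5 with h6 | h6
    · exact le_abs.2 (Or.inr (by linarith [hy.1]))
    · exact le_abs.2 (Or.inl (by linarith [hy.2]))

lemma exists_grid_near {t : ℝ} (ht : 0 ≤ t) (ht1 : t < 1) (k : ℕ) :
    ∃ i : ℕ, i < 4 ^ k ∧ |t - (i : ℝ) / 4 ^ k| ≤ (1 / 4) ^ k := by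
  have h4 : (0 : ℝ) < 4 ^ k := by positivity
  refine ⟨⌊t * 4 ^ k⌋₊, ?_, ?_⟩
  · rw [Nat.floor_lt (by positivity)]
    push_cast
    nlinarith
  · have h1 := Nat.floor_le (show 0 ≤ t * 4 ^ k by positivity)
    have h2 := Nat.lt_floor_add_one (t * 4 ^ k)
    have h3 : t - (⌊t * 4 ^ k⌋₊ : ℝ) / 4 ^ k = (t * 4 ^ k - ⌊t * 4 ^ k⌋₊) * (1 / 4) ^ k := by
      rw [one_div, inv_pow]
      field_simp
    rw [h3, abs_of_nonneg (mul_nonneg (by linarith) (by positivity))]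
    exact mul_le_of_le_one_left (by positivity) (by linarith)

/-- A lower bound on the grid extends almost surely to each point of the window. -/
lemma le_stochConv_of_mem_gridEvent (hW : IsIsonormal W P) {m a t x : ℝ} (ht : 2 ≤ t) (ht3 : t < 3)
    (hx : a ≤ x) (hx1 : x < a + 1) :
    ∀ᵐ ω ∂P, ω ∈ gridEvent W m a → m ≤ stochConv W t x ω := by
  have hstoch : stochConv W t x = W (convLp t x) := rfl
  rw [hstoch]
  have key : ∀ l : ℕ, ∀ᵐ ω ∂P, ω ∈ gridEvent W m a → m - 1 / (l + 1) ≤ W (convLp t x) ω := by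
    intro l
    have hδ : (0 : ℝ) < 1 / (l + 1) := by positivity
    -- The event on the left does not depend on `k`, while comparison with a grid point at distance
    -- `4 ^ (-k)` bounds it by a quantity tending to 0.
    have hbound : ∀ k : ℕ, P {ω | ¬ (ω ∈ gridEvent W m a → m - 1 / (l + 1) ≤ W (convLp t x) ω)}
        ≤ ENNReal.ofReal (1440 * (2 * (32 * (1 / 2) ^ k) / (1 / ((l : ℝ) + 1)) ^ 2) ^ 6) := by
      intro k
      obtain ⟨i, hi, hti⟩ := exists_grid_near (sub_nonneg.2 ht) (by linarith : t - 2 < 1) k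
      obtain ⟨j, hj, hxj⟩ := exists_grid_near (sub_nonneg.2 hx) (by linarith : x - a < 1) k
      have h1 := natCast_div_four_pow_lt hi
      refine le_trans (measure_mono fun ω hω => ?_) (hW.measure_le_abs_sub
        (convLp (2 + i / 4 ^ k) (a + j / 4 ^ k)) (convLp t x) (c := 32 * (1 / 2) ^ k)
        (by positivity) ?_ hδ)
      · obtain ⟨hE, hlt⟩ := Classical.not_imp.1 hω
        have h2 := hE k i j hi hj
        exact le_trans (by linarith) (le_abs_self
          (W (convLp (2 + i / 4 ^ k) (a + j / 4 ^ k)) ω - W (convLp t x) ω))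
      · rw [norm_sub_rev]
        refine (norm_convLp_sub_le (by positivity) (by linarith) (by linarith) _ _).trans ?_
        have h3 := sqrt_le_half_pow hti
        have h4 := sqrt_le_half_pow hxj
        rw [← sub_sub, ← sub_sub]
        linarith
    have hlim : Filter.Tendsto (fun k : ℕ => ENNReal.ofReal
        (1440 * (2 * (32 * (1 / 2) ^ k) / (1 / ((l : ℝ) + 1)) ^ 2) ^ 6)) Filter.atTop
        (nhds 0) := by
      have hp := tendsto_pow_atTop_nhds_zero_of_lt_one (r := (1 / 2 : ℝ)) (by norm_num)
        (by norm_num)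
      have h := ENNReal.tendsto_ofReal ((((((hp.const_mul 32).const_mul 2).div_const
        ((1 / ((l : ℝ) + 1)) ^ 2)).pow 6).const_mul 1440))
      simpa using h
    exact le_antisymm (ge_of_tendsto' hlim hbound) bot_le
  filter_upwards [ae_all_iff.2 key] with ω hω hE
  refine le_of_tendsto' (f := fun l : ℕ => m - 1 / ((l : ℝ) + 1)) (x := Filter.atTop) ?_
    fun l => hω l hE
  simpa using (tendsto_one_div_add_atTop_nhds_zero_nat (𝕜 := ℝ)).const_sub m

/-! ### Lower bounds for the reaction term -/

/-- A lower bound for the heat mass of a unit interval seen from one of its points, up to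
time `1`. -/
def massBound : ℝ := Real.exp (-1) * (√(4 * Real.pi))⁻¹ / 2

lemma massBound_pos : 0 < massBound := by
  unfold massBound
  positivity

lemma continuous_heatKernel (r x : ℝ) : Continuous (heatKernel r x) := by
  unfold heatKernel
  fun_prop

lemma massBound_le {r a x : ℝ} (hr : 0 < r) (hr1 : r ≤ 1) (hx : a ≤ x) (hx1 : x ≤ a + 1) :
    massBound ≤ ∫ y in Ioo a (a + 1), heatKernel r x y := by
  have hs : 0 < √r := Real.sqrt_pos.2 hr
  have hs1 : √r ≤ 1 := Real.sqrt_le_one.2 hr1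
  -- An interval of length `√r / 2` next to `x`, on the side where the unit interval has room. The
  -- kernel is of order `1 / √r` on it, so its mass does not degenerate as `r` tends to 0.
  obtain ⟨l, hl, hl', hlx⟩ : ∃ l, a ≤ l ∧ l + √r / 2 ≤ a + 1 ∧
      ∀ y ∈ Ioo l (l + √r / 2), |x - y| ≤ √r := by
    rcases le_total x (a + 1 / 2) with h | h
    · refine ⟨x, hx, by linarith, fun y hy => abs_le.2 ⟨?_, ?_⟩⟩ <;> linarith [hy.1, hy.2]
    · refine ⟨x - √r / 2, by linarith, by linarith, fun y hy => abs_le.2 ⟨?_, ?_⟩⟩ <;>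
        linarith [hy.1, hy.2]
  have hint : ∀ p q, IntegrableOn (heatKernel r x) (Ioo p q) := fun p q =>
    ((continuous_heatKernel r x).integrableOn_Icc).mono_set Ioo_subset_Icc_self
  have h1 : Real.exp (-1) * (√(4 * Real.pi * r))⁻¹ * volume.real (Ioo l (l + √r / 2))
      ≤ ∫ y in Ioo l (l + √r / 2), heatKernel r x y := by
    refine setIntegral_ge_of_const_le_real measurableSet_Ioo (by simp) (fun y hy => ?_) (hint _ _)
    rw [mul_comm]
    unfold heatKernel
    gcongr
    rw [neg_div, neg_le_neg_iff, div_le_one (by positivity)]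
    have h2 := pow_le_pow_left₀ (abs_nonneg _) (hlx y hy) 2
    rw [sq_abs, Real.sq_sqrt hr.le] at h2
    linarith
  have h2 : ∫ y in Ioo l (l + √r / 2), heatKernel r x y
      ≤ ∫ y in Ioo a (a + 1), heatKernel r x y :=
    setIntegral_mono_set (hint _ _) (Filter.Eventually.of_forall fun y => heatKernel_nonneg _ _ _)
      (Ioo_subset_Ioo hl hl').eventuallyLE
  refine le_trans (le_of_eq ?_) (h1.trans h2)
  rw [Real.volume_real_Ioo_of_le (by linarith), add_sub_cancel_left, Real.sqrt_mul (by positivity),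
    massBound]
  field_simp

lemma le_of_mildEquationAt {σ : ℝ} {b u₀ : ℝ → ℝ} {v : ℝ≥0 → ℝ → ℝ} {z : ℝ} {t : ℝ≥0} {x : ℝ}
    (hu₀ : ∀ y, 0 ≤ u₀ y) (h : MildEquationAt σ b u₀ v z t x) :
    (∫ s in (0 : ℝ)..t, ∫ y, heatKernel (t - s) x y * b (v s.toNNReal y)) + σ * z ≤ v t x := by
  rw [h.2.2]
  have : 0 ≤ ∫ y, heatKernel t x y * u₀ y :=
    integral_nonneg fun y => mul_nonneg (heatKernel_nonneg _ _ _) (hu₀ y)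
  linarith

lemma integral_reaction_nonneg {b : ℝ → ℝ} (hb : ∀ r, 0 ≤ b r) (v : ℝ≥0 → ℝ → ℝ) (t : ℝ≥0)
    (x : ℝ) : 0 ≤ ∫ s in (0 : ℝ)..t, ∫ y, heatKernel (t - s) x y * b (v s.toNNReal y) :=
  intervalIntegral.integral_nonneg t.2 fun _ _ =>
    integral_nonneg fun _ => mul_nonneg (heatKernel_nonneg _ _ _) (hb _)

/-- If a solution is at least `M` on the slab `(T, 3) × (a, a + 1)`, then the reaction term
accumulated between the times `T` and `T'` is felt at every later point of the window. -/
lemma le_integral_reaction {σ : ℝ} {b u₀ : ℝ → ℝ} {v : ℝ≥0 → ℝ → ℝ} {z : ℝ} {t : ℝ≥0} {x : ℝ}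
    {a M T T' : ℝ} (hb : ∀ r, 0 ≤ b r) (hmono : MonotoneOn b (Ioi 0)) (hM : 0 < M) (hT : 2 ≤ T)
    (hTT' : T ≤ T') (hT't : T' ≤ t) (ht3 : (t : ℝ) < 3) (hx : a ≤ x) (hx1 : x ≤ a + 1)
    (hv : ∀ᵐ s : ℝ, ∀ᵐ y : ℝ, s ∈ Ioo T 3 → y ∈ Ioo a (a + 1) → M ≤ v s.toNNReal y)
    (h : MildEquationAt σ b u₀ v z t x) :
    massBound * (T' - T) * b M
      ≤ ∫ s in (0 : ℝ)..t, ∫ y, heatKernel (t - s) x y * b (v s.toNNReal y) := by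
  set f : ℝ → ℝ := fun s => ∫ y, heatKernel (t - s) x y * b (v s.toNNReal y) with hf
  have hf0 : ∀ s, 0 ≤ f s := fun s =>
    integral_nonneg fun y => mul_nonneg (heatKernel_nonneg _ _ _) (hb _)
  have hint := h.2.1
  rw [IntegrableOn, Measure.volume_eq_prod, ← Measure.prod_restrict, Measure.restrict_univ] at hint
  have hfint : IntegrableOn f (Ioo 0 (t : ℝ)) := hint.integral_prod_left
  have hslice := (ae_restrict_iff' measurableSet_Ioo).1 hint.prod_right_ae
  have hsub : Ioo T T' ⊆ Ioo 0 (t : ℝ) := Ioo_subset_Ioo (by linarith) hT't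
  have hlow : ∀ᵐ s : ℝ, s ∈ Ioo T T' → massBound * b M ≤ f s := by
    filter_upwards [hslice, hv] with s hs1 hs2 hs
    have hst : s < t := (hsub hs).2
    have hI := hs1 (hsub hs)
    have hs3 : s ∈ Ioo T 3 := ⟨hs.1, hst.trans ht3⟩
    calc massBound * b M ≤ (∫ y in Ioo a (a + 1), heatKernel (t - s) x y) * b M := by
          refine mul_le_mul_of_nonneg_right (massBound_le (sub_pos.2 hst) ?_ hx hx1) (hb M)
          linarith [hs.1]
      _ = ∫ y in Ioo a (a + 1), heatKernel (t - s) x y * b M := (integral_mul_const _ _).symm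
      _ ≤ ∫ y in Ioo a (a + 1), heatKernel (t - s) x y * b (v s.toNNReal y) := by
        refine setIntegral_mono_on_ae ?_ hI.integrableOn measurableSet_Ioo ?_
        · exact (((continuous_heatKernel _ x).integrableOn_Icc).mono_set
            Ioo_subset_Icc_self).mul_const _
        · filter_upwards [hs2] with y hy hya
          have hMy := hy hs3 hya
          exact mul_le_mul_of_nonneg_left (hmono hM (hM.trans_le hMy) hMy)
            (heatKernel_nonneg _ _ _)
      _ ≤ f s := setIntegral_le_integral hI
        (Filter.Eventually.of_forall fun y => mul_nonneg (heatKernel_nonneg _ _ _) (hb _))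
  calc massBound * (T' - T) * b M = ∫ s in Ioo T T', massBound * b M := by
        rw [setIntegral_const, Real.volume_real_Ioo_of_le hTT', smul_eq_mul]
        ring
    _ ≤ ∫ s in Ioo T T', f s :=
      setIntegral_mono_on_ae (integrableOn_const (by simp)) (hfint.mono_set hsub)
        measurableSet_Ioo hlow
    _ ≤ ∫ s in Ioo 0 (t : ℝ), f s :=
      setIntegral_mono_set hfint (Filter.Eventually.of_forall hf0) hsub.eventuallyLE
    _ = ∫ s in (0 : ℝ)..t, f s := by
      rw [intervalIntegral.integral_of_le t.coe_nonneg, integral_Ioc_eq_integral_Ioo]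

/-! ### The Osgood condition and the doubling times -/

/-- Under the Osgood condition, `∑ 2 ^ k / b (2 ^ (k + 1))` converges. -/
lemma Osgood.exists_summable {b : ℝ → ℝ} (hb : ∀ r, 0 ≤ b r) (hmono : MonotoneOn b (Ioi 0))
    (h : Osgood b) :
    ∃ k₀ : ℕ, (∀ k, 0 < b (2 ^ (k₀ + k))) ∧
      Summable fun k => (2 : ℝ) ^ (k₀ + k) / b (2 ^ (k₀ + k)) := by
  obtain ⟨a, ha, hfin⟩ := h
  obtain ⟨k₁, hk₁⟩ := pow_unbounded_of_one_lt a (one_lt_two (α := ℝ))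
  -- A zero of `b` at `s` would by monotonicity make `b` vanish on `(a, s)`, where `1 / 0 = ∞` makes
  -- the integral diverge.
  have hpos : ∀ s, a < s → 0 < b s := by
    intro s hs
    refine lt_of_le_of_ne (hb s) fun h0 => ?_
    have hinf : ∫⁻ r in Ioo a s, (ENNReal.ofReal (b r))⁻¹ = ∞ := by
      have hcongr : ∫⁻ r in Ioo a s, (ENNReal.ofReal (b r))⁻¹ = ∫⁻ _ in Ioo a s, ∞ := by
        refine setLIntegral_congr_fun measurableSet_Ioo fun r hr => ?_
        have hr0 : b r ≤ 0 := h0 ▸ hmono (ha.trans hr.1) (ha.trans hs) hr.2.le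
        simp [ENNReal.ofReal_of_nonpos hr0]
      rw [hcongr, setLIntegral_const, Real.volume_Ioo, ENNReal.top_mul]
      simpa using hs
    exact absurd (lintegral_mono_set (μ := volume) (f := fun r => (ENNReal.ofReal (b r))⁻¹)
      (Ioo_subset_Ioi_self : Ioo a s ⊆ Ioi a)) (by rw [hinf]; exact not_le.2 hfin)
  have hlarge : ∀ k, a < 2 ^ (k₁ + k) := fun k =>
    hk₁.trans_le (pow_le_pow_right₀ one_le_two (Nat.le_add_right _ _))
  refine ⟨k₁ + 1, fun k => hpos _ ?_, ?_⟩
  · rw [add_assoc]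
    exact hlarge _
  have hterm : ∀ k, ENNReal.ofReal (2 ^ (k₁ + k) / b (2 ^ (k₁ + (k + 1))))
      ≤ ∫⁻ r in Ioc (2 ^ (k₁ + k) : ℝ) (2 ^ (k₁ + (k + 1))), (ENNReal.ofReal (b r))⁻¹ := by
    intro k
    have hbk := hpos _ (hlarge (k + 1))
    calc ENNReal.ofReal (2 ^ (k₁ + k) / b (2 ^ (k₁ + (k + 1))))
        = ∫⁻ _ in Ioc (2 ^ (k₁ + k) : ℝ) (2 ^ (k₁ + (k + 1))),
            (ENNReal.ofReal (b (2 ^ (k₁ + (k + 1)))))⁻¹ := by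
          rw [setLIntegral_const, Real.volume_Ioc, ← ENNReal.ofReal_inv_of_pos hbk,
            ← ENNReal.ofReal_mul (by positivity)]
          congr 1
          rw [← add_assoc, pow_succ]
          ring
      _ ≤ _ := by
        refine setLIntegral_mono' measurableSet_Ioc fun r hr => ?_
        have hr0 : 0 < r := lt_trans (by positivity) hr.1
        exact ENNReal.inv_le_inv.2 (ENNReal.ofReal_le_ofReal
          (hmono hr0 (hr0.trans_le hr.2) hr.2))
  have hmonopow : Monotone fun k : ℕ => (2 : ℝ) ^ (k₁ + k) := fun i j hij =>
    pow_le_pow_right₀ one_le_two (by omega)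
  have hsum : ∑' k, ENNReal.ofReal (2 ^ (k₁ + k) / b (2 ^ (k₁ + (k + 1)))) ≠ ∞ := by
    refine ne_top_of_le_ne_top hfin.ne ((ENNReal.tsum_le_tsum hterm).trans ?_)
    rw [← lintegral_iUnion (fun k => measurableSet_Ioc)
      (by simpa using hmonopow.pairwise_disjoint_on_Ioc_succ)]
    refine lintegral_mono_set (iUnion_subset fun k r hr => ?_)
    exact (hlarge k).trans hr.1
  have hs : Summable fun k => (2 : ℝ) ^ (k₁ + k) / b (2 ^ (k₁ + (k + 1))) := by
    have h1 := ENNReal.summable_toReal hsum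
    refine h1.congr fun k => ENNReal.toReal_ofReal ?_
    exact div_nonneg (by positivity) (hb _)
  refine (hs.mul_left 2).congr fun k => ?_
  rw [show k₁ + 1 + k = k₁ + (k + 1) by ring, ← add_assoc, pow_succ]
  ring

/-- Levels and times along which the solution doubles. -/
lemma Osgood.exists_levels {b : ℝ → ℝ} (hb : ∀ r, 0 ≤ b r) (hmono : MonotoneOn b (Ioi 0))
    (h : Osgood b) {c : ℝ} (hc : 0 < c) :
    ∃ M T : ℕ → ℝ, (∀ k, 0 < M k) ∧ Filter.Tendsto M Filter.atTop Filter.atTop ∧ T 0 = 2 ∧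
      Monotone T ∧ (∀ k, T k ≤ 5 / 2) ∧ ∀ k, c * (T (k + 1) - T k) * b (M k) = M (k + 1) := by
  obtain ⟨k₀, hpos, hsum⟩ := h.exists_summable hb hmono
  -- The time needed to double: `c * f k * b (2 ^ (k₀ + k)) = 2 * 2 ^ (k₀ + k)`. Starting from a
  -- later index `k₂` brings the total time below 1/2.
  set f : ℕ → ℝ := fun k => 2 / c * ((2 : ℝ) ^ (k₀ + k) / b (2 ^ (k₀ + k))) with hf
  have hf0 : ∀ k, 0 ≤ f k := fun k =>
    mul_nonneg (by positivity) (div_nonneg (by positivity) (hb _))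
  have hfs : Summable f := hsum.mul_left _
  obtain ⟨k₂, hk₂⟩ := ((tendsto_sum_nat_add f).eventually
    (gt_mem_nhds (show (0 : ℝ) < 1 / 2 by norm_num))).exists
  have hfs' : Summable fun k => f (k + k₂) := (summable_nat_add_iff k₂).2 hfs
  refine ⟨fun k => 2 ^ (k₀ + (k + k₂)), fun k => 2 + ∑ l ∈ Finset.range k, f (l + k₂),
    fun k => by positivity, ?_, by simp, ?_, ?_, ?_⟩
  · refine (tendsto_pow_atTop_atTop_of_one_lt (one_lt_two (α := ℝ))).comp ?_
    exact Filter.tendsto_atTop_mono (fun k => by simp only [id]; omega) Filter.tendsto_id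
  · refine monotone_nat_of_le_succ fun k => ?_
    rw [Finset.sum_range_succ]
    linarith [hf0 (k + k₂)]
  · intro k
    have := hfs'.sum_le_tsum (Finset.range k) fun l _ => hf0 _
    linarith
  · intro k
    have := hpos (k + k₂)
    simp only [Finset.sum_range_succ, ← add_assoc (2 : ℝ), add_sub_cancel_left, hf]
    rw [show k₀ + (k + 1 + k₂) = k₀ + (k + k₂) + 1 by ring, pow_succ]
    field_simp

/-! ### Explosion of solutions -/

variable {σ : ℝ} {b u₀ : ℝ → ℝ}
  {u : ℝ≥0 → ℝ → Ω → ℝ} {τ : Ω → WithTop ℝ≥0}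

/-- Fubini: a lower bound holding almost surely at each point of a slab holds, almost surely,
at almost every point. -/
lemma IsLocalSolution.ae_ae_le (hu : IsLocalSolution W ℱ P σ b u₀ u τ) {A : Set Ω}
    (hA : MeasurableSet A) {a M T : ℝ} (hT : 0 ≤ T)
    (h : ∀ t : ℝ≥0, T ≤ t → (t : ℝ) < 3 → ∀ x, a ≤ x → x < a + 1 →
      ∀ᵐ ω ∂P, ω ∈ A → M ≤ u t x ω) :
    ∀ᵐ ω ∂P, ω ∈ A →
      ∀ᵐ s : ℝ, ∀ᵐ y : ℝ, s ∈ Ioo T 3 → y ∈ Ioo a (a + 1) → M ≤ u s.toNNReal y ω := by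
  let p : ℝ × ℝ → Ω → Prop := fun q ω =>
    q ∈ Ioo T 3 ×ˢ Ioo a (a + 1) → ω ∈ A → M ≤ u q.1.toNNReal q.2 ω
  have hmeas : MeasurableSet {x : (ℝ × ℝ) × Ω | p x.1 x.2} := by
    have hu' : Measurable fun x : (ℝ × ℝ) × Ω => u x.1.1.toNNReal x.1.2 x.2 :=
      hu.measurable.comp (f := fun x : (ℝ × ℝ) × Ω => (x.1.1.toNNReal, x.1.2, x.2)) (by fun_prop)
    refine MeasurableSet.imp ?_ (MeasurableSet.imp (measurable_snd hA)
      (measurableSet_le measurable_const hu'))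
    exact measurable_fst (measurableSet_Ioo.prod measurableSet_Ioo)
  have hae : ∀ᵐ q : ℝ × ℝ, ∀ᵐ ω ∂P, p q ω := by
    refine Filter.Eventually.of_forall fun q => ?_
    by_cases hq : q ∈ Ioo T 3 ×ˢ Ioo a (a + 1)
    · have hq1 : (q.1.toNNReal : ℝ) = q.1 := Real.coe_toNNReal _ (hT.trans hq.1.1.le)
      filter_upwards [h q.1.toNNReal (by rw [hq1]; exact hq.1.1.le) (by rw [hq1]; exact hq.1.2)
        q.2 hq.2.1.le hq.2.2] with ω hω _
      exact hω
    · exact Filter.Eventually.of_forall fun ω hq' => absurd hq' hq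
  filter_upwards [(Measure.ae_ae_comm hmeas).1 hae] with ω hω hωA
  filter_upwards [Measure.ae_ae_of_ae_prod hω] with s hs
  filter_upwards [hs] with y hy hs' hy'
  exact hy ⟨hs', hy'⟩ hωA

/-- Where the stochastic convolution is large on a window, a solution has to explode. -/
lemma IsLocalSolution.ae_notMem (hu : IsLocalSolution W ℱ P σ b u₀ u τ) (hσ : 0 < σ)
    (hu₀ : ∀ x, 0 ≤ u₀ x) (hb : ∀ r, 0 ≤ b r) (hmono : MonotoneOn b (Ioi 0)) {M T : ℕ → ℝ}
    (hM : ∀ k, 0 < M k) (hMlim : Filter.Tendsto M Filter.atTop Filter.atTop) (hT0 : T 0 = 2)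
    (hTmono : Monotone T) (hT : ∀ k, T k ≤ 5 / 2)
    (hstep : ∀ k, massBound * (T (k + 1) - T k) * b (M k) = M (k + 1)) {A : Set Ω}
    (hA : MeasurableSet A) (hAτ : ∀ ω ∈ A, ((3 : ℝ≥0) : WithTop ℝ≥0) < τ ω) {a : ℝ}
    (hZ : ∀ t x : ℝ, 2 ≤ t → t < 3 → a ≤ x → x < a + 1 →
      ∀ᵐ ω ∂P, ω ∈ A → M 0 / σ ≤ stochConv W t x ω) :
    ∀ᵐ ω ∂P, ω ∉ A := by
  have hT2 : ∀ k, 2 ≤ T k := fun k => hT0 ▸ hTmono (Nat.zero_le k)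
  have hlevel : ∀ k, ∀ t : ℝ≥0, T k ≤ t → (t : ℝ) < 3 → ∀ x, a ≤ x → x < a + 1 →
      ∀ᵐ ω ∂P, ω ∈ A → M k ≤ u t x ω := by
    have hmild : ∀ t : ℝ≥0, 2 ≤ (t : ℝ) → (t : ℝ) < 3 → ∀ x, ∀ᵐ ω ∂P, ω ∈ A →
        MildEquationAt σ b u₀ (fun s y => u s y ω) (stochConv W t x ω) t x := by
      intro t ht ht3 x
      filter_upwards [hu.mild t (by exact_mod_cast (by linarith : (0 : ℝ) < t)) x] with ω hω hωA
      refine hω (lt_trans ?_ (hAτ ω hωA))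
      exact_mod_cast ht3
    intro k
    induction k with
    | zero =>
      intro t ht ht3 x hx hx1
      have ht2 := (hT2 0).trans ht
      filter_upwards [hmild t ht2 ht3 x, hZ t x ht2 ht3 hx hx1] with ω h1 h2 hωA
      refine le_trans ?_ (le_of_mildEquationAt hu₀ (h1 hωA))
      have h3 := integral_reaction_nonneg hb (fun s y => u s y ω) t x
      have h4 := h2 hωA
      rw [div_le_iff₀' hσ] at h4
      linarith
    | succ k ih =>
      intro t ht ht3 x hx hx1
      have ht2 := (hT2 (k + 1)).trans ht
      filter_upwards [hmild t ht2 ht3 x, hZ t x ht2 ht3 hx hx1,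
        hu.ae_ae_le hA (by linarith [hT2 k]) ih] with ω h1 h2 h3 hωA
      refine le_trans ?_ (le_of_mildEquationAt hu₀ (h1 hωA))
      have h4 := le_integral_reaction hb hmono (hM k) (hT2 k) (hTmono (Nat.le_succ k)) ht ht3 hx
        hx1.le (h3 hωA) (h1 hωA)
      rw [hstep] at h4
      -- After the first level the noise only has to be nonnegative; the reaction alone provides `M
      -- (k + 1)`.
      have h5 : 0 ≤ σ * stochConv W t x ω :=
        mul_nonneg hσ.le (le_trans (div_pos (hM 0) hσ).le (h2 hωA))
      linarith
  -- Every `T k` is at most 5/2, so all levels bound the value at one and the same point `(5 / 2,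
  -- a)`.
  have h52 : ((5 / 2 : ℝ≥0) : ℝ) = 5 / 2 := by norm_num
  filter_upwards [ae_all_iff.2 fun k => hlevel k (5 / 2) (by rw [h52]; exact hT k)
    (by rw [h52]; norm_num) a le_rfl (by linarith)] with ω hω hωA
  obtain ⟨k, hk⟩ := (hMlim.eventually_gt_atTop (u (5 / 2) a ω)).exists
  exact absurd (hω k hωA) (not_le.2 hk)

/-- Under the Osgood condition every local solution explodes, in fact before time `3`. -/
lemma IsWhiteNoise.almostSurelyNoGlobalSolution (hW : IsWhiteNoise W ℱ P) (hσ : 0 < σ)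
    (hu₀ : ∀ x, 0 ≤ u₀ x) (hb : ∀ r, 0 ≤ b r) (hmono : MonotoneOn b (Ioi 0)) (hO : Osgood b) :
    AlmostSurelyNoGlobalSolution W ℱ P σ b u₀ := by
  intro u τ hu
  have hI := hW.isIsonormal
  obtain ⟨M, T, hM, hMlim, hT0, hTmono, hT, hstep⟩ := hO.exists_levels hb hmono massBound_pos
  -- Survival past time 3 is incompatible with each favourable window, and some window is favourable
  -- with probability arbitrarily close to 1.
  let B : Set Ω := {ω | τ ω ≤ ((3 : ℝ≥0) : WithTop ℝ≥0)}ᶜ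
  have hB : MeasurableSet B := (ℱ.le 3 _ (hu.stopping 3)).compl
  have hBτ : ∀ ω ∈ B, ((3 : ℝ≥0) : WithTop ℝ≥0) < τ ω := fun ω hω => not_le.1 hω
  have hnull : ∀ a, P (gridEvent W (M 0 / σ) a ∩ B) = 0 := by
    intro a
    have h := hu.ae_notMem hσ hu₀ hb hmono hM hMlim hT0 hTmono hT hstep
      (A := gridEvent W (M 0 / σ) a ∩ B) ((measurableSet_gridEvent hI _ _).inter hB)
      (fun ω hω => hBτ ω hω.2) (a := a) fun t x ht ht3 hx hx1 => by
        filter_upwards [le_stochConv_of_mem_gridEvent hI (m := M 0 / σ) ht ht3 hx hx1] with ω hω hA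
        exact hω hA.1
    simpa [ae_iff] using h
  have hPB : P B = 0 := by
    have hle : ∀ n : ℕ, P B ≤ ENNReal.ofReal (1 / ((n : ℝ) + 1)) := by
      intro n
      obtain ⟨N, a, ha⟩ := exists_gridEvent hI (M 0 / σ) (show (0 : ℝ) < 1 / ((n : ℝ) + 1) by
        positivity)
      calc P B ≤ P ((⋃ i, gridEvent W (M 0 / σ) (a i) ∩ B) ∪
            (⋃ i, gridEvent W (M 0 / σ) (a i))ᶜ) := by
            refine measure_mono fun ω hω => ?_
            rw [← iUnion_inter]
            by_cases h : ω ∈ ⋃ i, gridEvent W (M 0 / σ) (a i)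
            · exact Or.inl ⟨h, hω⟩
            · exact Or.inr h
        _ ≤ 0 + ENNReal.ofReal (1 / ((n : ℝ) + 1)) := by
          refine (measure_union_le _ _).trans (add_le_add (le_of_eq ?_) ha)
          exact measure_iUnion_null fun i => hnull (a i)
        _ = _ := zero_add _
    have hlim := ENNReal.tendsto_ofReal (tendsto_one_div_add_atTop_nhds_zero_nat (𝕜 := ℝ))
    rw [ENNReal.ofReal_zero] at hlim
    exact le_antisymm (ge_of_tendsto' hlim hle) bot_le
  have hae : ∀ᵐ ω ∂P, ω ∉ B := measure_eq_zero_iff_ae_notMem.1 hPB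
  filter_upwards [hae] with ω hω
  exact lt_of_le_of_lt (not_not.1 hω) (WithTop.coe_lt_top _)

lemma osgood_of_eq_rpow {b : ℝ → ℝ} {η : ℝ} (hη : 0 < η) (hb : ∀ r, 0 ≤ r → b r = r ^ (1 + η)) :
    Osgood b := by
  refine ⟨1, one_pos, ?_⟩
  have hint := integrableOn_Ioi_rpow_of_lt (show -(1 + η) < -1 by linarith) one_pos
  refine lt_of_le_of_lt (le_of_eq ?_) hint.lintegral_lt_top
  refine setLIntegral_congr_fun measurableSet_Ioi fun s hs => ?_
  have hs0 : 0 < s := one_pos.trans hs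
  rw [hb s hs0.le, ← ENNReal.ofReal_inv_of_pos (Real.rpow_pos_of_pos hs0 _),
    Real.rpow_neg hs0.le]

end StochasticHeat

end

theorem mainTheorem2 {Ω : Type*} {mΩ : MeasurableSpace Ω} (P : Measure Ω) [IsProbabilityMeasure P]
    (ℱ : Filtration ℝ≥0 mΩ) (W : Lp ℝ 2 StochasticHeat.spaceTime → Ω → ℝ)
    (hW : StochasticHeat.IsWhiteNoise W ℱ P) (σ : ℝ) (hσ : 0 < σ)
    (u₀ : ℝ → ℝ) (hu₀ : Continuous u₀) (hu₀_nonneg : ∀ x, 0 ≤ u₀ x) :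
    (∀ b : ℝ → ℝ, (∀ r, 0 ≤ b r) → LocallyLipschitz b → MonotoneOn b (Ioi 0) →
      StochasticHeat.Osgood b →
      StochasticHeat.AlmostSurelyNoGlobalSolution W ℱ P σ b u₀) ∧
    (∀ η : ℝ, 0 < η → ∀ b : ℝ → ℝ, (∀ r, 0 ≤ b r) → LocallyLipschitz b →
      (∀ r, 0 ≤ r → b r = r ^ (1 + η)) →
      StochasticHeat.AlmostSurelyNoGlobalSolution W ℱ P σ b u₀) := by
  refine ⟨fun b hb _ hmono hO => hW.almostSurelyNoGlobalSolution hσ hu₀_nonneg hb hmono hO,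
    fun η hη b hb _ hbη => hW.almostSurelyNoGlobalSolution hσ hu₀_nonneg hb (fun r hr s hs hrs => ?_)
      (StochasticHeat.osgood_of_eq_rpow hη hbη)⟩
  have hr0 : 0 ≤ r := (mem_Ioi.1 hr).le
  rw [hbη r hr0, hbη s (hr0.trans hrs)]
  exact Real.rpow_le_rpow hr0 hrs (by linarith)
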